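/- Let $g=\mathrm{diag}(-1,1,1,1)$ on $\mathbb R^4$ (indices $0,\dots,3$, raised and lowered with $g$, summation convention), and let $\Psi=\{\psi\in\mathbb R^4:\psi_\gamma\psi^\gamma<0,\ \psi^0>0\}$. For $\psi\in\Psi$ put $\theta=(-\psi_\gamma\psi^\gamma)^{-1/2}$, $u^\gamma=\theta\psi^\gamma$, $p(\theta)=\frac13\theta^4$, $\Pi^{\alpha\beta}=u^\alpha u^\beta+g^{\alpha\beta}$, and $$T^{\alpha\beta}(\psi)=\theta^3p'(\theta)\psi^\alpha\psi^\beta+p(\theta)g^{\alpha\beta},\qquad B^{\alpha\beta\gamma\delta}=\eta B^{\alpha\beta\gamma\delta}_{visc}-\mu B^{\alpha\beta\gamma\delta}_{ther}-\nu B^{\alpha\beta\gamma\delta}_{velo},$$ $$B_{visc}^{\alpha\beta\gamma\delta}=\Pi^{\alpha\gamma}\Pi^{\beta\delta}+\Pi^{\alpha\delta}\Pi^{\beta\gamma}-\tfrac23\Pi^{\alpha\beta}\Pi^{\gamma\delta},\qquad B_{ther}^{\alpha\beta\gamma\delta}=(3u^\alpha u^\beta+\Pi^{\alpha\beta})(3u^\gamma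 u^\delta+\Pi^{\gamma\delta}),$$ $$B_{velo}^{\alpha\beta\gamma\delta}=(u^\alpha{\Pi^\beta}_\epsilon+u^\beta{\Pi^\alpha}_\epsilon)(u^\gamma\Pi^{\delta\epsilon}+u^\delta\Pi^{\gamma\epsilon}).$$ For a spacelike covector $\xi$, a Lax shock with normal $\xi$ is a pair $\psi_-,\psi_+\in\Psi$ (the states in $x^\beta\xi_\beta<0$ and in $x^\beta\xi_\beta>0$) with $\xi_\beta T^{\alpha\beta}(\psi_-)=\xi_\beta T^{\alpha\beta}(\psi_+)=:q^\alpha$ such that, for some $k\in\{1,2,3,4\}$, the characteristic speeds $c_1\le\dots\le c_4$ of $\partial_\beta T^{\alpha\beta}=0$ relative to the front $x^\beta\xi_\beta=0$ satisfy $c_{k-1}(\psi_-)<0<c_k(\psi_-)$ and $c_k(\psi_+)<0<c_{k+1}(\psi_+)$ (inequalities involving $c_0$ or $c_5$ being void). Its amplitude is the Euclidean length of $\psi_+-\psi_-$ in the rest frame of $\psi_-$, divided by $1/\theta(\psi_-)$. A dissipation profile of the shock is a $C^1$ solution $\hat\psi:\mathbb R\to\Psi$ of $$\xi_\beta\xi_\delta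 B^{\alpha\beta\gamma\delta}(\psi)\,\psi_\gamma'=\xi_\beta T^{\alpha\beta}(\psi)-q^\alpha$$ with $\hat\psi(-\infty)=\psi_-$ and $\hat\psi(+\infty)=\psi_+$. **Theorem 1.** Let $\eta,\mu,\nu>0$ be constants. (i) There is an $\varepsilon>0$, depending only on $\eta,\mu,\nu$, such that every Lax shock, with any spacelike normal $\xi$, of amplitude less than $\varepsilon$ has a dissipation profile. (ii) If the strict causality condition $$\mu\ge\tfrac43\eta\quad\text{and}\quad\nu>\Big(\frac1{3\eta}-\frac1{9\mu}\Big)^{-1}$$ holds, then for every spacelike normal $\xi$ there is a Lax shock that has no dissipation profile. -/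

import Mathlib

noncomputable section

open Filter Topology
open scoped BigOperators

namespace BDN

/-- Vectors and covectors of Minkowski space-time, by their components `0, 1, 2, 3`.
The component `0` is the time component. -/
abbrev Vec := Fin 4 → ℝ

/-- The Minkowski metric `diag(-1, 1, 1, 1)`. It is its own inverse, so that the same array
serves for upper and for lower indices. -/
def g (α β : Fin 4) : ℝ := if α = β then (if α = 0 then -1 else 1) else 0

/-- Lowering an index: `(lower w)_γ = g_{γ ε} w^ε`. -/
def lower (w : Vec) : Vec := fun γ => ∑ ε, g γ ε * w ε

/-- The Minkowski product `g_{α β} v^α w^β`. -/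
def mink (v w : Vec) : ℝ := ∑ α, ∑ β, g α β * v α * w β

/-- A covector `ξ` is spacelike. -/
def Spacelike (ξ : Vec) : Prop := 0 < ∑ α, ∑ β, g α β * ξ α * ξ β

/-- The state space: future-directed timelike vectors `ψ^γ = u^γ / θ`. -/
def stateSpace : Set Vec := {ψ | mink ψ ψ < 0 ∧ 0 < ψ 0}

/-- The temperature `θ = (-ψ_γ ψ^γ)^(-1/2)`. -/
def temp (ψ : Vec) : ℝ := (Real.sqrt (-mink ψ ψ))⁻¹

/-- The velocity `u^γ = θ ψ^γ`. -/
def vel (ψ : Vec) : Vec := fun γ => temp ψ * ψ γ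

/-- The pressure law of pure radiation. -/
def pressure (θ : ℝ) : ℝ := 1 / 3 * θ ^ 4

/-- The ideal stress `T^{α β} = θ³ p'(θ) ψ^α ψ^β + p(θ) g^{α β}`. -/
def T (ψ : Vec) (α β : Fin 4) : ℝ :=
  temp ψ ^ 3 * deriv pressure (temp ψ) * ψ α * ψ β + pressure (temp ψ) * g α β

/-- The projector `Π^{α β} = u^α u^β + g^{α β}`. -/
def proj (ψ : Vec) (α β : Fin 4) : ℝ := vel ψ α * vel ψ β + g α β

/-- The projector with its second index lowered, `Π^α_ε`. -/
def projMixed (ψ : Vec) (α ε : Fin 4) : ℝ := ∑ κ, proj ψ α κ * g κ ε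

def Bvisc (ψ : Vec) (α β γ δ : Fin 4) : ℝ :=
  proj ψ α γ * proj ψ β δ + proj ψ α δ * proj ψ β γ - 2 / 3 * (proj ψ α β * proj ψ γ δ)

def Bther (ψ : Vec) (α β γ δ : Fin 4) : ℝ :=
  (3 * vel ψ α * vel ψ β + proj ψ α β) * (3 * vel ψ γ * vel ψ δ + proj ψ γ δ)

def Bvelo (ψ : Vec) (α β γ δ : Fin 4) : ℝ :=
  ∑ ε, (vel ψ α * projMixed ψ β ε + vel ψ β * projMixed ψ α ε) *
    (vel ψ γ * proj ψ δ ε + vel ψ δ * proj ψ γ ε)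

/-- The dissipation coefficients `B^{α β γ δ}` of the model. -/
def B (η μ ν : ℝ) (ψ : Vec) (α β γ δ : Fin 4) : ℝ :=
  η * Bvisc ψ α β γ δ - μ * Bther ψ α β γ δ - ν * Bvelo ψ α β γ δ

/-- The flux `ζ_β T^{α β}(ψ)` through the hyperplanes with normal covector `ζ`. -/
def flux (ζ ψ : Vec) : Vec := fun α => ∑ β, ζ β * T ψ α β

/-- The Jacobian `ζ_β ∂T^{α β} / ∂ψ^γ` of the flux. -/
def fluxJacobian (ζ ψ : Vec) : Matrix (Fin 4) (Fin 4) ℝ :=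
  Matrix.of fun α γ => fderiv ℝ (flux ζ) ψ (Pi.single γ 1) α

/-- The covector `dt`. -/
def dt : Vec := Pi.single 0 1

/-- `c 0, …, c 3` are the characteristic speeds at the state `ψ` of the ideal fluid equations
`∂_β T^{α β} = 0`, relative to the planar front `x^β ξ_β = 0`, each listed with its multiplicity:
the zeros `σ` of the characteristic polynomial `det ((ξ_β - σ (dt)_β) ∂T^{α β} / ∂ψ^γ)`.
The plane wave front with covector `ξ - σ dt` moves with velocity `σ / |(ξ_1, ξ_2, ξ_3)|` relative
to that with covector `ξ`, in the direction of increasing `x^β ξ_β`; the positive factor is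
immaterial for what follows. -/
def IsCharSpeeds (ξ ψ c : Vec) : Prop :=
  (fluxJacobian dt ψ).det ≠ 0 ∧
  ∀ σ : ℝ, (fluxJacobian (ξ - σ • dt) ψ).det = (fluxJacobian dt ψ).det * ∏ i, (c i - σ)

/-- The discontinuous wave with the state `ψm` in `x^β ξ_β < 0` and `ψp` in `x^β ξ_β > 0` is a
Lax shock of the ideal fluid equations: the Rankine-Hugoniot conditions and, for some `k`, the
Lax inequalities `c_{k-1}(ψm) < 0 < c_k(ψm)` and `c_k(ψp) < 0 < c_{k+1}(ψp)` for the
characteristic speeds relative to the front. -/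
structure IsLaxShock (ξ ψm ψp : Vec) : Prop where
  mem_left : ψm ∈ stateSpace
  mem_right : ψp ∈ stateSpace
  rankine_hugoniot : flux ξ ψm = flux ξ ψp
  lax : ∃ (k : Fin 4) (cm cp : Vec), Monotone cm ∧ Monotone cp ∧
    IsCharSpeeds ξ ψm cm ∧ IsCharSpeeds ξ ψp cp ∧
    (∀ i, i < k → cm i < 0) ∧ 0 < cm k ∧ cp k < 0 ∧ (∀ i, k < i → 0 < cp i)

/-- The relative amplitude of a shock: the Euclidean length of the jump `ψp - ψm` in the rest
frame of `ψm`, that is, in the metric `g_{α β} + 2 u_α u_β` with `u = vel ψm`, divided by the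
length `1 / θ` of `ψm`. It does not depend on the Lorentz frame nor on the unit of temperature. -/
def amplitude (ψm ψp : Vec) : ℝ :=
  temp ψm * Real.sqrt (mink (ψp - ψm) (ψp - ψm) + 2 * mink (vel ψm) (ψp - ψm) ^ 2)

/-- `ψ` is a dissipation profile: a classical solution on `ℝ` of
`ξ_β ξ_δ B^{α β γ δ}(ψ) ψ_γ' = ξ_β T^{α β}(ψ) - q^α`, `q^α = ξ_β T^{α β}(ψm)`, that takes its
values in the state space and is heteroclinic from `ψm` to `ψp`. -/
structure IsProfile (η μ ν : ℝ) (ξ ψm ψp : Vec) (ψ : ℝ → Vec) : Prop where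
  contDiff : ContDiff ℝ 1 ψ
  mem : ∀ x, ψ x ∈ stateSpace
  ode : ∀ x α, (∑ β, ∑ γ, ∑ δ, ξ β * ξ δ * B η μ ν (ψ x) α β γ δ * lower (deriv ψ x) γ)
    = flux ξ (ψ x) α - flux ξ ψm α
  tendsto_left : Tendsto ψ atBot (𝓝 ψm)
  tendsto_right : Tendsto ψ atTop (𝓝 ψp)

/-- The wave with states `ψm`, `ψp` and normal `ξ` has a dissipation profile. -/
def HasProfile (η μ ν : ℝ) (ξ ψm ψp : Vec) : Prop := ∃ ψ, IsProfile η μ ν ξ ψm ψp ψ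

end BDN

end

noncomputable section

open Filter Topology
open scoped BigOperators

namespace BDN

/-! Let `n` be the unit normal of the front and `e` a timelike unit vector orthogonal to it. The
characteristic polynomial of the ideal fluid is the square of a linear factor, whose root is the
speed of the fluid, times an acoustic quadratic with one root on either side (`exists_charSpeeds`).
Hence a Lax shock belongs to the first or the last family, with a supersonic state on one side and a
subsonic one on the other (`IsLaxShock.cases`). The Rankine-Hugoniot conditions put both states into
a common plane, `ψ = ρ (e + v n)`, and make their velocities conjugate, `a * b = 1 / 3`
(`exists_planar_pair`). Reflection of the front exchanges the two families.

Weak shocks. Conjugate velocities that are close together are close to the sonic value `1 / √3`. In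
the plane the profile equation is a system for `v` and the energy flux `energy ρ v * v`. Put `D = (a
- v) * (v - b)`, choose the time so that `v' = -D`, and write the energy flux as `Q * (1 - κ * D)`.
The factor `D` resolves the degeneracy at both rest points: what remains is one nonautonomous scalar
equation for `κ`, which at the sonic point is `κ' = -lam * (κ - 3/2)` with `lam > 0`. By continuity
the strip `0 ≤ κ ≤ 3` stays invariant and the equation contracting for weak shocks
(`eventually_goodPoint`), so there is a solution on the whole line (`exists_solution_in_strip`). As
`κ` is bounded and `D` tends to `0` at both ends, the curve joins the two states. It solves the
profile equation after a positive bounded change of time (`hasProfile_of_goodPoint`).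

Strong shocks. Strict causality makes the dissipation form negative definite at a supersonic state
with `v` close to `1` (`dissForm_neg`), while the Jacobian of the flux is positive definite there
(`mink_fluxDeriv_pos`). If `M ψ' = f(ψ)` with `M` negative and `f'` positive at a rest point `p`,
then `U = M(p)(ψ - p, ψ - p)` is nonpositive and nondecreasing near `p`. A solution that comes from
`p` at `-∞` therefore has `U = 0` and never leaves `p` (`eq_rest_point_of_tendsto_atBot`). -/

/-! ### Algebra of the Minkowski product. -/

theorem mink_eq (v w : Vec) :
    mink v w = -(v 0 * w 0) + v 1 * w 1 + v 2 * w 2 + v 3 * w 3 := by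
  simp [mink, g, Fin.sum_univ_four]

theorem lower_zero (w : Vec) : lower w 0 = -w 0 := by
  simp [lower, g]

theorem lower_of_ne (w : Vec) {i : Fin 4} (hi : i ≠ 0) : lower w i = w i := by
  simp [lower, g, hi]

theorem lower_lower (w : Vec) : lower (lower w) = w := by
  funext i
  by_cases hi : i = 0
  · subst hi; simp [lower_zero]
  · simp [lower_of_ne _ hi]

theorem mink_comm (v w : Vec) : mink v w = mink w v := by
  simp only [mink_eq]; ring

theorem mink_add_left (v w z : Vec) : mink (v + w) z = mink v z + mink w z := by
  simp only [mink_eq, Pi.add_apply]; ring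

theorem mink_smul_left (a : ℝ) (v z : Vec) : mink (a • v) z = a * mink v z := by
  simp only [mink_eq, Pi.smul_apply, smul_eq_mul]; ring

theorem mink_add_right (v w z : Vec) : mink z (v + w) = mink z v + mink z w := by
  simp only [mink_eq, Pi.add_apply]; ring

theorem mink_smul_right (a : ℝ) (v z : Vec) : mink z (a • v) = a * mink z v := by
  simp only [mink_eq, Pi.smul_apply, smul_eq_mul]; ring

theorem mink_neg_right (v w : Vec) : mink v (-w) = -mink v w := by
  simp only [mink_eq, Pi.neg_apply]; ring

theorem mink_neg_left (v w : Vec) : mink (-v) w = -mink v w := by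
  simp only [mink_eq, Pi.neg_apply]; ring

theorem mink_sub_left (v w z : Vec) : mink (v - w) z = mink v z - mink w z := by
  simp only [mink_eq, Pi.sub_apply]; ring

theorem mink_sub_right (v w z : Vec) : mink z (v - w) = mink z v - mink z w := by
  simp only [mink_eq, Pi.sub_apply]; ring

theorem sum_mul_eq_mink (ξ ψ : Vec) : ∑ β, ξ β * ψ β = mink (lower ξ) ψ := by
  simp [mink_eq, Fin.sum_univ_four, lower_zero, lower_of_ne]

theorem spacelike_iff (ξ : Vec) : Spacelike ξ ↔ 0 < mink (lower ξ) (lower ξ) := by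
  have : ∑ α, ∑ β, g α β * ξ α * ξ β = mink (lower ξ) (lower ξ) := by
    simp [mink_eq, Fin.sum_univ_four, lower_zero, lower_of_ne, g]
  rw [Spacelike, this]

theorem lower_neg (ξ : Vec) : lower (-ξ) = -lower ξ := by
  funext i
  simp [lower, Finset.sum_neg_distrib]

/-- The reversed Cauchy-Schwarz inequality decides the time orientation. -/
theorem time_pos_of_mink_neg {u w : Vec} (hu : mink u u < 0) (hu0 : 0 < u 0) (hw : mink w w < 0)
    (h : mink u w < 0) : 0 < w 0 := by
  rw [mink_eq] at hu hw h
  by_contra! hw0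
  have hcs : (u 1 * w 1 + u 2 * w 2 + u 3 * w 3) ^ 2 ≤
      (u 1 ^ 2 + u 2 ^ 2 + u 3 ^ 2) * (w 1 ^ 2 + w 2 ^ 2 + w 3 ^ 2) := by
    nlinarith [sq_nonneg (u 1 * w 2 - u 2 * w 1), sq_nonneg (u 1 * w 3 - u 3 * w 1),
      sq_nonneg (u 2 * w 3 - u 3 * w 2)]
  have h1 : (u 0 * w 0) ^ 2 ≤ (u 1 * w 1 + u 2 * w 2 + u 3 * w 3) ^ 2 := by
    have : u 1 * w 1 + u 2 * w 2 + u 3 * w 3 < u 0 * w 0 := by linarith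
    have h' : u 0 * w 0 ≤ 0 := mul_nonpos_of_nonneg_of_nonpos hu0.le hw0
    nlinarith
  have h2 : (u 1 ^ 2 + u 2 ^ 2 + u 3 ^ 2) * (w 1 ^ 2 + w 2 ^ 2 + w 3 ^ 2) < u 0 ^ 2 * w 0 ^ 2 := by
    apply mul_lt_mul'' <;> nlinarith [sq_nonneg (u 1), sq_nonneg (u 2), sq_nonneg (u 3),
      sq_nonneg (w 1), sq_nonneg (w 2), sq_nonneg (w 3)]
  nlinarith

/-- A nonzero vector orthogonal to a timelike one is spacelike. -/
theorem mink_self_pos_of_orthogonal {u w : Vec} (hu : mink u u < 0) (hw : w ≠ 0)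
    (h : mink u w = 0) : 0 < mink w w := by
  rw [mink_eq] at hu h
  have hcs : (u 1 * w 1 + u 2 * w 2 + u 3 * w 3) ^ 2 ≤
      (u 1 ^ 2 + u 2 ^ 2 + u 3 ^ 2) * (w 1 ^ 2 + w 2 ^ 2 + w 3 ^ 2) := by
    nlinarith [sq_nonneg (u 1 * w 2 - u 2 * w 1), sq_nonneg (u 1 * w 3 - u 3 * w 1),
      sq_nonneg (u 2 * w 3 - u 3 * w 2)]
  have hu0 : 0 < u 0 ^ 2 := by nlinarith [sq_nonneg (u 1), sq_nonneg (u 2), sq_nonneg (u 3)]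
  have hs : 0 < w 1 ^ 2 + w 2 ^ 2 + w 3 ^ 2 := by
    by_contra! hs
    have h1 : w 1 = 0 := by nlinarith [sq_nonneg (w 1), sq_nonneg (w 2), sq_nonneg (w 3)]
    have h2 : w 2 = 0 := by nlinarith [sq_nonneg (w 1), sq_nonneg (w 2), sq_nonneg (w 3)]
    have h3 : w 3 = 0 := by nlinarith [sq_nonneg (w 1), sq_nonneg (w 2), sq_nonneg (w 3)]
    have h0 : w 0 = 0 := by
      rw [h1, h2, h3] at h
      have : u 0 * w 0 = 0 := by linarith
      rcases mul_eq_zero.1 this with h' | h'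
      · rw [h'] at hu0; norm_num at hu0
      · exact h'
    apply hw
    funext i
    fin_cases i <;> assumption
  have h1 : u 0 ^ 2 * w 0 ^ 2 < u 0 ^ 2 * (w 1 ^ 2 + w 2 ^ 2 + w 3 ^ 2) := by
    have e1 : u 0 ^ 2 * w 0 ^ 2 = (u 1 * w 1 + u 2 * w 2 + u 3 * w 3) ^ 2 := by
      rw [← mul_pow]; congr 1; linarith
    rw [e1]
    refine hcs.trans_lt (mul_lt_mul_of_pos_right ?_ hs)
    nlinarith
  have h2 := lt_of_mul_lt_mul_left h1 hu0.le
  rw [mink_eq]; nlinarith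

/-! ### Temperature, velocity and the ideal flux. -/

theorem temp_pos {ψ : Vec} (h : mink ψ ψ < 0) : 0 < temp ψ :=
  inv_pos.2 (Real.sqrt_pos.2 (by linarith))

theorem temp_sq {ψ : Vec} (h : mink ψ ψ < 0) : temp ψ ^ 2 * mink ψ ψ = -1 := by
  rw [temp, inv_pow, Real.sq_sqrt (by linarith)]
  field_simp [h.ne]

theorem vel_eq_smul (ψ : Vec) : vel ψ = temp ψ • ψ := rfl

theorem mink_vel_self {ψ : Vec} (h : mink ψ ψ < 0) : mink (vel ψ) (vel ψ) = -1 := by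
  rw [vel_eq_smul, mink_smul_left, mink_smul_right, ← temp_sq h]; ring

theorem deriv_pressure (θ : ℝ) : deriv pressure θ = 4 / 3 * θ ^ 3 := by
  have : HasDerivAt pressure (1 / 3 * (4 * θ ^ 3)) θ := by
    exact ((hasDerivAt_pow 4 θ).const_mul (1 / 3 : ℝ)).congr_deriv (by norm_num)
  rw [this.deriv]; ring

theorem flux_eq (ξ ψ : Vec) (α : Fin 4) :
    flux ξ ψ α = temp ψ ^ 4 *
      (4 / 3 * mink (vel ψ) (lower ξ) * vel ψ α + 1 / 3 * lower ξ α) := by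
  have h1 : flux ξ ψ α = temp ψ ^ 6 * (4 / 3) * (∑ β, ξ β * ψ β) * ψ α
      + 1 / 3 * temp ψ ^ 4 * lower ξ α := by
    simp only [flux, T, deriv_pressure, pressure, lower, Fin.sum_univ_four]
    ring
  rw [h1, sum_mul_eq_mink, vel_eq_smul, mink_smul_left, mink_comm ψ, Pi.smul_apply, smul_eq_mul]
  ring

/-! ### Contraction of the dissipation tensor. -/

/-- The vector `ξ_β ξ_δ B^{α β γ δ} w_γ`. -/
def diss (η μ ν : ℝ) (ξ ψ w : Vec) : Vec := fun α =>
  ∑ β, ∑ γ, ∑ δ, ξ β * ξ δ * B η μ ν ψ α β γ δ * lower w γ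

theorem sum_proj_mul_lower (ψ w : Vec) (α : Fin 4) :
    ∑ γ, proj ψ α γ * lower w γ = w α + mink (vel ψ) w * vel ψ α := by
  have h2 : ∑ γ, g α γ * lower w γ = w α := congrFun (lower_lower w) α
  have h1 : ∑ γ, vel ψ γ * lower w γ = mink (vel ψ) w := by
    rw [show (∑ γ, vel ψ γ * lower w γ) = ∑ γ, lower w γ * vel ψ γ from
      Finset.sum_congr rfl fun _ _ => mul_comm _ _, sum_mul_eq_mink, lower_lower, mink_comm]
  simp only [proj, add_mul, Finset.sum_add_distrib, h2, mul_assoc, ← Finset.mul_sum, h1]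
  ring

theorem sum_proj_mul (ψ ξ : Vec) (α : Fin 4) :
    ∑ γ, proj ψ α γ * ξ γ = lower ξ α + mink (vel ψ) (lower ξ) * vel ψ α := by
  have := sum_proj_mul_lower ψ (lower ξ) α
  rwa [lower_lower] at this

theorem proj_comm (ψ : Vec) (α β : Fin 4) : proj ψ α β = proj ψ β α := by
  simp only [proj, g]
  rw [mul_comm]
  by_cases h : α = β
  · subst h; rfl
  · simp [h, Ne.symm h]

theorem sum_visc (ψ ξ ω : Vec) (α : Fin 4) :
    ∑ β, ∑ γ, ∑ δ, ξ β * ξ δ * Bvisc ψ α β γ δ * ω γ =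
      (∑ γ, proj ψ α γ * ω γ) * (∑ β, ξ β * ∑ δ, proj ψ β δ * ξ δ) +
      1 / 3 * (∑ δ, proj ψ α δ * ξ δ) * (∑ γ, ω γ * ∑ δ, proj ψ γ δ * ξ δ) := by
  simp only [Bvisc]
  simp only [Fin.sum_univ_four, proj_comm ψ 1 0, proj_comm ψ 2 0, proj_comm ψ 3 0, proj_comm ψ 2 1,
    proj_comm ψ 3 1, proj_comm ψ 3 2]
  ring

theorem sum_ther (ψ ξ ω : Vec) (α : Fin 4) :
    ∑ β, ∑ γ, ∑ δ, ξ β * ξ δ * Bther ψ α β γ δ * ω γ =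
      (3 * (∑ β, ξ β * vel ψ β) * vel ψ α + ∑ β, proj ψ α β * ξ β) *
      (3 * (∑ β, ξ β * vel ψ β) * (∑ γ, ω γ * vel ψ γ) +
        ∑ γ, ω γ * ∑ δ, proj ψ γ δ * ξ δ) := by
  simp only [Bther, Fin.sum_univ_four]
  ring

theorem sum_velo (ψ ξ ω : Vec) (α : Fin 4) :
    ∑ β, ∑ γ, ∑ δ, ξ β * ξ δ * Bvelo ψ α β γ δ * ω γ =
      ∑ ε, (vel ψ α * (∑ β, ξ β * projMixed ψ β ε) + (∑ β, ξ β * vel ψ β) * projMixed ψ α ε) *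
        ((∑ γ, ω γ * vel ψ γ) * (∑ δ, proj ψ ε δ * ξ δ) +
          (∑ β, ξ β * vel ψ β) * (∑ γ, proj ψ ε γ * ω γ)) := by
  have h : ∀ β γ δ, ξ β * ξ δ * Bvelo ψ α β γ δ * ω γ =
      ∑ ε, ξ β * ξ δ * ((vel ψ α * projMixed ψ β ε + vel ψ β * projMixed ψ α ε) *
        (vel ψ γ * proj ψ ε δ + vel ψ δ * proj ψ ε γ)) * ω γ := by
    intro β γ δ
    rw [Bvelo, Finset.mul_sum, Finset.sum_mul]
    refine Finset.sum_congr rfl fun ε _ => ?_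
    rw [proj_comm ψ δ ε, proj_comm ψ γ ε]
  simp only [h]
  rw [Finset.sum_congr rfl fun β _ => (Finset.sum_congr rfl fun γ _ => Finset.sum_comm).trans
    Finset.sum_comm, Finset.sum_comm]
  refine Finset.sum_congr rfl fun ε _ => ?_
  simp only [Fin.sum_univ_four]
  ring

theorem sum_projMixed_mul (ψ Z : Vec) (α : Fin 4) :
    ∑ ε, projMixed ψ α ε * Z ε = Z α + mink (vel ψ) Z * vel ψ α := by
  rw [← sum_proj_mul_lower]
  simp [projMixed, lower, g, Fin.sum_univ_four]

theorem sum_mul_projMixed (ψ ξ : Vec) (ε : Fin 4) :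
    ∑ β, ξ β * projMixed ψ β ε = lower (lower ξ + mink (vel ψ) (lower ξ) • vel ψ) ε := by
  have : lower ξ + mink (vel ψ) (lower ξ) • vel ψ = fun α => ∑ γ, proj ψ α γ * ξ γ := by
    funext α; simp [sum_proj_mul]
  rw [this]
  simp only [projMixed, lower, Finset.mul_sum]
  rw [Finset.sum_comm]
  refine Finset.sum_congr rfl fun κ _ => Finset.sum_congr rfl fun β _ => ?_
  rw [proj_comm ψ β κ]
  have : g κ ε = g ε κ := by
    by_cases h : κ = ε
    · rw [h]
    · simp [g, h, Ne.symm h]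
  rw [this]; ring

/-- The dissipation in terms of the projections of `lower ξ` and `w` to the rest space. -/
theorem diss_eq (η μ ν : ℝ) (ξ w : Vec) {ψ : Vec} (hψ : mink ψ ψ < 0) {N PN PW : Vec}
    {τ b P K : ℝ} (hN : N = lower ξ) (hτ : τ = mink (vel ψ) N) (hb : b = mink (vel ψ) w)
    (hP : P = mink N w + τ * b) (hK : K = mink N N + τ ^ 2)
    (hPN : PN = N + τ • vel ψ) (hPW : PW = w + b • vel ψ) :
    diss η μ ν ξ ψ w = η • (K • PW + (P / 3) • PN)
      - (μ * (3 * τ * b + P)) • ((3 * τ) • vel ψ + PN)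
      - ν • ((b * K + τ * P) • vel ψ + τ • (b • PN + τ • PW)) := by
  have hu := mink_vel_self hψ
  funext α
  have e1 : ∀ α, ∑ δ, proj ψ α δ * ξ δ = PN α := by
    intro α; rw [sum_proj_mul, ← hN, ← hτ, hPN]; simp
  have e2 : ∀ α, ∑ γ, proj ψ α γ * lower w γ = PW α := by
    intro α; rw [sum_proj_mul_lower, ← hb, hPW]; simp
  have e3 : ∑ β, ξ β * vel ψ β = τ := by rw [sum_mul_eq_mink, ← hN, hτ, mink_comm]
  have e4 : ∑ γ, lower w γ * vel ψ γ = b := by rw [sum_mul_eq_mink, lower_lower, hb, mink_comm]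
  have e5 : ∑ β, ξ β * PN β = K := by
    rw [sum_mul_eq_mink, ← hN, hPN, mink_add_right, mink_smul_right, hK, mink_comm N (vel ψ), ← hτ]; ring
  have e6 : ∑ γ, lower w γ * PN γ = P := by
    rw [sum_mul_eq_mink, lower_lower, hPN, mink_add_right, mink_smul_right, hP, mink_comm w N,
      mink_comm w (vel ψ), ← hb]
  have e7 : ∀ Z : Vec, ∑ ε, lower PN ε * Z ε = mink PN Z := by
    intro Z; rw [sum_mul_eq_mink, lower_lower]
  have split : diss η μ ν ξ ψ w α =
      η * ∑ β, ∑ γ, ∑ δ, ξ β * ξ δ * Bvisc ψ α β γ δ * lower w γ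
      - μ * ∑ β, ∑ γ, ∑ δ, ξ β * ξ δ * Bther ψ α β γ δ * lower w γ
      - ν * ∑ β, ∑ γ, ∑ δ, ξ β * ξ δ * Bvelo ψ α β γ δ * lower w γ := by
    simp only [diss, Finset.mul_sum, ← Finset.sum_sub_distrib]
    refine Finset.sum_congr rfl fun β _ => Finset.sum_congr rfl fun γ _ =>
      Finset.sum_congr rfl fun δ _ => ?_
    rw [B]; ring
  -- This vector lies in the rest space of the fluid, so that the projector in `Bvelo` leaves it
  -- unchanged.
  have hVZ : mink (vel ψ) (b • PN + τ • PW) = 0 := by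
    rw [hPN, hPW]
    simp only [mink_add_right, mink_smul_right, hu, ← hτ, ← hb]
    ring
  have hPNZ : mink PN (b • PN + τ • PW) = b * K + τ * P := by
    rw [hPN, hPW, hK, hP]
    simp only [mink_add_right, mink_smul_right, mink_add_left, mink_smul_left, hu, ← hτ, ← hb,
      mink_comm N (vel ψ)]
    ring
  rw [split, sum_visc, sum_ther, sum_velo]
  simp only [e1, e2, e3, e4, e5, e6, sum_mul_projMixed, ← hN, ← hτ, ← hPN]
  have e8 : ∑ ε, (vel ψ α * lower PN ε + τ * projMixed ψ α ε) * (b * PN ε + τ * PW ε) =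
      vel ψ α * (b * K + τ * P) + τ * (b * PN α + τ * PW α) := by
    have h1 := e7 (b • PN + τ • PW)
    have h2 := sum_projMixed_mul ψ (b • PN + τ • PW) α
    rw [hPNZ] at h1
    rw [hVZ] at h2
    simp only [Pi.add_apply, Pi.smul_apply, smul_eq_mul] at h1 h2
    simp only [add_mul, Finset.sum_add_distrib, mul_assoc, ← Finset.mul_sum]
    rw [h1, h2]; ring
  rw [e8]
  simp only [Pi.sub_apply, Pi.add_apply, Pi.smul_apply, smul_eq_mul]
  ring

/-! ### Jacobian of the ideal flux and its determinant. -/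

/-- The linear form `mink v`. -/
def minkForm (v : Vec) : Vec →L[ℝ] ℝ :=
  LinearMap.toContinuousLinearMap
    { toFun := mink v
      map_add' := fun w z => mink_add_right w z v
      map_smul' := fun a w => mink_smul_right a w v }

@[simp] theorem minkForm_apply (v w : Vec) : minkForm v w = mink v w := rfl

theorem hasFDerivAt_mink_self (ψ : Vec) :
    HasFDerivAt (fun φ : Vec => mink φ φ) ((2 : ℝ) • minkForm ψ) ψ := by
  have h : ∀ i : Fin 4, HasFDerivAt (fun φ : Vec => φ i)
    (ContinuousLinearMap.proj (R := ℝ) (φ := fun _ : Fin 4 => ℝ) i) ψ := fun i => hasFDerivAt_apply i ψ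
  have h1 := (((((h 0).mul (h 0)).neg).add ((h 1).mul (h 1))).add ((h 2).mul (h 2))).add
    ((h 3).mul (h 3))
  have e : (fun φ : Vec => mink φ φ) = fun φ : Vec =>
      -(φ 0 * φ 0) + φ 1 * φ 1 + φ 2 * φ 2 + φ 3 * φ 3 := by
    funext φ; rw [mink_eq]
  rw [e]
  refine h1.congr_fderiv ?_
  ext w
  simp [mink_eq]
  ring

theorem continuous_mink_self : Continuous fun φ : Vec => mink φ φ :=
  continuous_iff_continuousAt.2 fun ψ => (hasFDerivAt_mink_self ψ).continuousAt

/-- The derivative of the flux in the direction `w`. -/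
def fluxDeriv (ζ ψ w : Vec) : Vec :=
  (4 / 3 * temp ψ ^ 6) • ((mink (lower ζ) w + 6 * temp ψ ^ 2 * mink (lower ζ) ψ * mink ψ w) • ψ
    + mink (lower ζ) ψ • w + mink ψ w • lower ζ)

/-- Only even powers of the temperature occur, and its square is rational in `ψ`. The flux can thus
be differentiated without the square root. -/
theorem flux_eq_rational (ζ : Vec) {ψ : Vec} (h : mink ψ ψ < 0) (α : Fin 4) :
    flux ζ ψ α = -(4 / 3) * (mink (lower ζ) ψ * ψ α * (mink ψ ψ ^ 3)⁻¹)
      + 1 / 3 * lower ζ α * (mink ψ ψ ^ 2)⁻¹ := by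
  rw [flux_eq, vel_eq_smul, mink_smul_left, mink_comm ψ, Pi.smul_apply, smul_eq_mul]
  have ht : temp ψ ^ 2 = -(mink ψ ψ)⁻¹ := by
    have := temp_sq h
    field_simp [h.ne]
    linarith
  have h4 : temp ψ ^ 4 = (mink ψ ψ ^ 2)⁻¹ := by
    rw [show temp ψ ^ 4 = (temp ψ ^ 2) ^ 2 by ring, ht]; field_simp
  have h6 : temp ψ ^ 6 = -(mink ψ ψ ^ 3)⁻¹ := by
    rw [show temp ψ ^ 6 = (temp ψ ^ 2) ^ 3 by ring, ht]; field_simp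
  have : temp ψ ^ 4 * (4 / 3 * (temp ψ * mink (lower ζ) ψ) * (temp ψ * ψ α) + 1 / 3 * lower ζ α)
    = temp ψ ^ 6 * (4 / 3 * mink (lower ζ) ψ * ψ α) + temp ψ ^ 4 * (1 / 3 * lower ζ α) := by ring
  rw [this, h4, h6]; ring

theorem hasFDerivAt_flux (ζ : Vec) {ψ : Vec} (h : mink ψ ψ < 0) :
    ∃ L : Vec →L[ℝ] Vec, HasFDerivAt (flux ζ) L ψ ∧ ∀ w, L w = fluxDeriv ζ ψ w := by
  have hm := hasFDerivAt_mink_self ψ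
  have hz : HasFDerivAt (fun φ : Vec => mink (lower ζ) φ) (minkForm (lower ζ)) ψ :=
    (minkForm (lower ζ)).hasFDerivAt
  have hne := h.ne
  have hcomp : ∀ α, HasFDerivAt (fun φ : Vec => flux ζ φ α) _ ψ := fun α => by
    have hα : HasFDerivAt (fun φ : Vec => φ α)
      (ContinuousLinearMap.proj (R := ℝ) (φ := fun _ : Fin 4 => ℝ) α) ψ := hasFDerivAt_apply α ψ
    have i3 := (hasDerivAt_inv (pow_ne_zero 3 hne)).comp_hasFDerivAt ψ (hm.pow 3)
    have i2 := (hasDerivAt_inv (pow_ne_zero 2 hne)).comp_hasFDerivAt ψ (hm.pow 2)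
    have := (((hz.mul hα).mul i3).const_mul (-(4 / 3))).add (i2.const_mul (1 / 3 * lower ζ α))
    refine this.congr_of_eventuallyEq ?_
    filter_upwards [continuous_mink_self.continuousAt.eventually (gt_mem_nhds h)] with φ hφ
    rw [flux_eq_rational ζ hφ]
    rfl
  refine ⟨_, hasFDerivAt_pi.2 hcomp, fun w => ?_⟩
  funext α
  have ht : temp ψ ^ 2 = -(mink ψ ψ)⁻¹ := by
    have := temp_sq h
    field_simp
    linarith
  have h6 : temp ψ ^ 6 = -(mink ψ ψ ^ 3)⁻¹ := by
    rw [show temp ψ ^ 6 = (temp ψ ^ 2) ^ 3 by ring, ht]; field_simp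
  simp [fluxDeriv, h6, ht]
  field_simp
  ring

theorem fluxJacobian_apply (ζ : Vec) {ψ : Vec} (h : mink ψ ψ < 0) (α γ : Fin 4) :
    fluxJacobian ζ ψ α γ = fluxDeriv ζ ψ (Pi.single γ 1) α := by
  obtain ⟨L, hL, hLw⟩ := hasFDerivAt_flux ζ h
  rw [fluxJacobian, Matrix.of_apply, hL.fderiv, hLw]

/-- The matrix is `t` times the identity plus `a bᵀ + c dᵀ`. The rank-two part reduces the
determinant to a `2 × 2` one and leaves a factor `t ^ 2`. The flux Jacobian has this form up to a
scalar factor, with `t = mink (lower ζ) ψ`, which is why the speed of the fluid is a double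
characteristic speed. -/
theorem det_rank_two_update (t a0 a1 a2 a3 b0 b1 b2 b3 c0 c1 c2 c3 d0 d1 d2 d3 : ℝ) :
    (!![t + a0*b0 + c0*d0, a0*b1 + c0*d1, a0*b2 + c0*d2, a0*b3 + c0*d3;
      a1*b0 + c1*d0, t + a1*b1 + c1*d1, a1*b2 + c1*d2, a1*b3 + c1*d3;
      a2*b0 + c2*d0, a2*b1 + c2*d1, t + a2*b2 + c2*d2, a2*b3 + c2*d3;
      a3*b0 + c3*d0, a3*b1 + c3*d1, a3*b2 + c3*d2, t + a3*b3 + c3*d3] :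
      Matrix (Fin 4) (Fin 4) ℝ).det =
    t ^ 2 * ((t + (a0*b0+a1*b1+a2*b2+a3*b3)) * (t + (c0*d0+c1*d1+c2*d2+c3*d3)) -
      (a0*d0+a1*d1+a2*d2+a3*d3) * (c0*b0+c1*b1+c2*b2+c3*b3)) := by
  rw [Matrix.det_succ_row_zero]
  simp [Fin.sum_univ_four, Matrix.det_fin_three, Fin.succAbove]
  ring

theorem det_fluxJacobian (ζ : Vec) {ψ : Vec} (h : mink ψ ψ < 0) :
    (fluxJacobian ζ ψ).det = -((4 / 3 * temp ψ ^ 6) ^ 4 * mink (lower ζ) ψ ^ 2 *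
      (2 * mink (lower ζ) ψ ^ 2 + mink ψ ψ * mink (lower ζ) (lower ζ))) := by
  set z := mink (lower ζ) ψ with hz
  set c := 6 * temp ψ ^ 2 * z with hc
  have hform : fluxJacobian ζ ψ = (4 / 3 * temp ψ ^ 6) •
     !![z + ψ 0 * (ζ 0 + c * -ψ 0) + -ζ 0 * -ψ 0, ψ 0 * (ζ 1 + c * ψ 1) + -ζ 0 * ψ 1,
        ψ 0 * (ζ 2 + c * ψ 2) + -ζ 0 * ψ 2, ψ 0 * (ζ 3 + c * ψ 3) + -ζ 0 * ψ 3;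
        ψ 1 * (ζ 0 + c * -ψ 0) + ζ 1 * -ψ 0, z + ψ 1 * (ζ 1 + c * ψ 1) + ζ 1 * ψ 1,
        ψ 1 * (ζ 2 + c * ψ 2) + ζ 1 * ψ 2, ψ 1 * (ζ 3 + c * ψ 3) + ζ 1 * ψ 3;
        ψ 2 * (ζ 0 + c * -ψ 0) + ζ 2 * -ψ 0, ψ 2 * (ζ 1 + c * ψ 1) + ζ 2 * ψ 1,
        z + ψ 2 * (ζ 2 + c * ψ 2) + ζ 2 * ψ 2, ψ 2 * (ζ 3 + c * ψ 3) + ζ 2 * ψ 3;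
        ψ 3 * (ζ 0 + c * -ψ 0) + ζ 3 * -ψ 0, ψ 3 * (ζ 1 + c * ψ 1) + ζ 3 * ψ 1,
        ψ 3 * (ζ 2 + c * ψ 2) + ζ 3 * ψ 2, z + ψ 3 * (ζ 3 + c * ψ 3) + ζ 3 * ψ 3] := by
    ext α γ
    rw [fluxJacobian_apply ζ h, fluxDeriv, ← hz, ← hc]
    fin_cases α <;> fin_cases γ <;>
      simp [mink_eq, lower_zero, lower_of_ne] <;> left <;> ring
  rw [hform, Matrix.det_smul, det_rank_two_update, Fintype.card_fin]
  have hz' : z = ζ 0 * ψ 0 + ζ 1 * ψ 1 + ζ 2 * ψ 2 + ζ 3 * ψ 3 := by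
    rw [hz, mink_eq]; simp [lower_zero, lower_of_ne]
  have hm := mink_eq ψ ψ
  have hX : mink (lower ζ) (lower ζ) = -(ζ 0 * ζ 0) + ζ 1 * ζ 1 + ζ 2 * ζ 2 + ζ 3 * ζ 3 := by
    rw [mink_eq]; simp [lower_zero, lower_of_ne]
  have i1 : ψ 0 * (ζ 0 + c * -ψ 0) + ψ 1 * (ζ 1 + c * ψ 1) + ψ 2 * (ζ 2 + c * ψ 2) +
      ψ 3 * (ζ 3 + c * ψ 3) = z + c * mink ψ ψ := by rw [hz', hm]; ring
  have i2 : -ζ 0 * -ψ 0 + ζ 1 * ψ 1 + ζ 2 * ψ 2 + ζ 3 * ψ 3 = z := by rw [hz']; ring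
  have i3 : ψ 0 * -ψ 0 + ψ 1 * ψ 1 + ψ 2 * ψ 2 + ψ 3 * ψ 3 = mink ψ ψ := by rw [hm]; ring
  have i4 : -ζ 0 * (ζ 0 + c * -ψ 0) + ζ 1 * (ζ 1 + c * ψ 1) + ζ 2 * (ζ 2 + c * ψ 2) +
      ζ 3 * (ζ 3 + c * ψ 3) = mink (lower ζ) (lower ζ) + c * z := by rw [hX, hz']; ring
  rw [i1, i2, i3, i4]
  have hcm : c * mink ψ ψ = -6 * z := by rw [hc]; linear_combination 6 * z * temp_sq h
  have : (z + (z + c * mink ψ ψ)) * (z + z) - mink ψ ψ * (mink (lower ζ) (lower ζ) + c * z)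
      = -(2 * z ^ 2 + mink ψ ψ * mink (lower ζ) (lower ζ)) := by
    linear_combination z * hcm
  rw [this]; ring

/-! ### Characteristic speeds. -/

theorem exists_roots_of_neg {L B C w : ℝ} (hL : 0 < L) (h : L * w ^ 2 + 2 * B * w + C < 0) :
    ∃ r₁ r₂, r₁ < w ∧ w < r₂ ∧ ∀ σ, L * σ ^ 2 + 2 * B * σ + C = L * ((r₁ - σ) * (r₂ - σ)) := by
  have hD : 0 < B ^ 2 - L * C := by nlinarith [sq_nonneg (L * w + B)]
  set s := Real.sqrt (B ^ 2 - L * C)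
  have hs : s ^ 2 = B ^ 2 - L * C := Real.sq_sqrt hD.le
  have hs0 : 0 < s := Real.sqrt_pos.2 hD
  have hw : (L * w + B) ^ 2 < s ^ 2 := by rw [hs]; nlinarith
  have hw' := abs_lt.1 (abs_lt_of_sq_lt_sq hw hs0.le)
  refine ⟨(-B - s) / L, (-B + s) / L, ?_, ?_, fun σ => ?_⟩
  · rw [div_lt_iff₀ hL]; linarith [hw'.1]
  · rw [lt_div_iff₀ hL]; linarith [hw'.2]
  · field_simp
    linear_combination hs

theorem mink_lower_sub_dt (ξ ψ : Vec) (σ : ℝ) :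
    mink (lower (ξ - σ • dt)) ψ = mink (lower ξ) ψ - σ * ψ 0 := by
  simp [mink_eq, lower_zero, lower_of_ne, dt]; ring

theorem mink_lower_sub_dt_self (ξ : Vec) (σ : ℝ) :
    mink (lower (ξ - σ • dt)) (lower (ξ - σ • dt)) =
      mink (lower ξ) (lower ξ) + 2 * σ * ξ 0 - σ ^ 2 := by
  simp [mink_eq, lower_zero, lower_of_ne, dt]; ring

/-- The characteristic speeds: a double one, that of the fluid, between the two acoustic ones. -/
theorem exists_charSpeeds {ξ ψ : Vec} (hξ : Spacelike ξ) (hψ : ψ ∈ stateSpace) :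
    ∃ r₁ w r₂ L : ℝ, r₁ < w ∧ w < r₂ ∧ 0 < L ∧ IsCharSpeeds ξ ψ ![r₁, w, w, r₂] ∧
      w * ψ 0 = mink (lower ξ) ψ ∧
      L * (r₁ * r₂) = 2 * mink (lower ξ) ψ ^ 2 + mink ψ ψ * mink (lower ξ) (lower ξ) := by
  obtain ⟨hm, h0⟩ := hψ
  set m := mink ψ ψ with hmdef
  set z := mink (lower ξ) ψ with hz
  set X := mink (lower ξ) (lower ξ) with hX
  have hL : 0 < 2 * ψ 0 ^ 2 - m := by nlinarith [sq_nonneg (ψ 0)]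
  have hw0 : z / ψ 0 * ψ 0 = z := div_mul_cancel₀ _ h0.ne'
  set w := z / ψ 0 with hwdef
  -- At the speed of the fluid the shifted covector is orthogonal to the timelike `ψ`, hence
  -- spacelike. This makes the acoustic quadratic negative there, so that its roots lie on either
  -- side.
  have horth : mink ψ (lower (ξ - w • dt)) = 0 := by
    rw [mink_comm, mink_lower_sub_dt, ← hz, hw0, sub_self]
  have hne : lower (ξ - w • dt) ≠ 0 := by
    intro h
    rw [spacelike_iff, ← hX] at hξ
    have h' : ξ - w • dt = 0 := by
      rw [← lower_lower (ξ - w • dt), h]; funext i; simp [lower]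
    have h1 : ξ 1 = 0 := by simpa [dt] using congrFun h' 1
    have h2 : ξ 2 = 0 := by simpa [dt] using congrFun h' 2
    have h3 : ξ 3 = 0 := by simpa [dt] using congrFun h' 3
    rw [hX, mink_eq] at hξ
    simp [lower_zero, lower_of_ne, h1, h2, h3] at hξ
    nlinarith [mul_self_nonneg (ξ 0)]
  have hpos := mink_self_pos_of_orthogonal hm hne horth
  rw [mink_lower_sub_dt_self, ← hX] at hpos
  have hneg : (2 * ψ 0 ^ 2 - m) * w ^ 2 + 2 * (m * ξ 0 - 2 * z * ψ 0) * w + (2 * z ^ 2 + m * X)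
      < 0 := by
    have : (2 * ψ 0 ^ 2 - m) * w ^ 2 + 2 * (m * ξ 0 - 2 * z * ψ 0) * w + (2 * z ^ 2 + m * X) =
      m * (X + 2 * w * ξ 0 - w ^ 2) := by
      linear_combination (2 * w * ψ 0 - 2 * z) * hw0
    rw [this]; exact mul_neg_of_neg_of_pos hm hpos
  obtain ⟨r₁, r₂, h1, h2, hr⟩ := exists_roots_of_neg hL hneg
  have hdt0 : mink (lower dt) ψ = ψ 0 := by simp [mink_eq, lower_zero, lower_of_ne, dt]
  have hdt1 : mink (lower dt) (lower dt) = -1 := by simp [mink_eq, lower_zero, lower_of_ne, dt]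
  have hdet : (fluxJacobian dt ψ).det =
      -((4 / 3 * temp ψ ^ 6) ^ 4 * ψ 0 ^ 2 * (2 * ψ 0 ^ 2 - m)) := by
    rw [det_fluxJacobian dt hm, hdt0, hdt1]; ring
  refine ⟨r₁, w, r₂, _, h1, h2, hL, ⟨?_, fun σ => ?_⟩, hw0, ?_⟩
  · rw [hdet]
    have := temp_pos hm
    exact neg_ne_zero.2 (by positivity)
  · rw [hdet, det_fluxJacobian _ hm, mink_lower_sub_dt, mink_lower_sub_dt_self, ← hz, ← hX,
      ← hmdef]
    have hr' := hr σ
    simp only [Fin.prod_univ_four, Matrix.cons_val_zero, Matrix.cons_val_one, Matrix.cons_val]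
    rw [← hw0] at hr' ⊢
    linear_combination (-((4 / 3 * temp ψ ^ 6) ^ 4 * (w * ψ 0 - σ * ψ 0) ^ 2)) * hr'
  · have := hr 0
    linarith

/-- Two lists of characteristic speeds have the same characteristic polynomial. -/
theorem IsCharSpeeds.eq_of_prod {ξ ψ c c' : Vec} (h : IsCharSpeeds ξ ψ c)
    (h' : IsCharSpeeds ξ ψ c') (σ : ℝ) : ∏ i, (c i - σ) = ∏ i, (c' i - σ) :=
  mul_left_cancel₀ h.1 ((h.2 σ).symm.trans (h'.2 σ))

/-- Equality of the values and of the product is all that the Lax inequalities require; the two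
lists need not be matched entry by entry. -/
theorem IsCharSpeeds.exists_eq {ξ ψ c c' : Vec} (h : IsCharSpeeds ξ ψ c)
    (h' : IsCharSpeeds ξ ψ c') (i : Fin 4) : ∃ j, c' j = c i := by
  have h0 : ∏ j, (c' j - c i) = 0 := by
    rw [← h.eq_of_prod h' (c i)]
    exact Finset.prod_eq_zero (Finset.mem_univ i) (sub_self _)
  obtain ⟨j, -, hj⟩ := Finset.prod_eq_zero_iff.1 h0
  exact ⟨j, sub_eq_zero.1 hj⟩

/-! ### Frames adapted to a front and planar states. -/

/-- A future-directed timelike unit vector and a spacelike unit vector orthogonal to it. -/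
structure IsFrame (e n : Vec) : Prop where
  ee : mink e e = -1
  en : mink e n = 0
  nn : mink n n = 1
  fut : 0 < e 0

/-- The state of the plane of `e`, `n` with velocity `v` in the direction of `n`. -/
def planar (e n : Vec) (ρ v : ℝ) : Vec := ρ • (e + v • n)

theorem IsFrame.mink_comb {e n : Vec} (h : IsFrame e n) (a b c d : ℝ) :
    mink (a • e + b • n) (c • e + d • n) = b * d - a * c := by
  simp only [mink_add_left, mink_add_right, mink_smul_left, mink_smul_right, h.ee, h.en, h.nn,
    mink_comm n e]
  ring

theorem planar_eq (e n : Vec) (ρ v : ℝ) : planar e n ρ v = ρ • e + (ρ * v) • n := by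
  rw [planar, smul_add, smul_smul]

theorem IsFrame.mink_planar {e n : Vec} (h : IsFrame e n) (ρ v : ℝ) :
    mink (planar e n ρ v) (planar e n ρ v) = -(ρ ^ 2 * (1 - v ^ 2)) := by
  rw [planar_eq, h.mink_comb]; ring

theorem IsFrame.planar_mem {e n : Vec} (h : IsFrame e n) {ρ v : ℝ} (hρ : 0 < ρ)
    (hv : v ^ 2 < 1) : planar e n ρ v ∈ stateSpace := by
  have h1 : mink (planar e n ρ v) (planar e n ρ v) < 0 := by
    rw [h.mink_planar]
    have : 0 < 1 - v ^ 2 := by linarith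
    exact neg_neg_of_pos (by positivity)
  refine ⟨h1, time_pos_of_mink_neg (u := e) (by rw [h.ee]; norm_num) h.fut h1 ?_⟩
  have := h.mink_comb 1 0 ρ (ρ * v)
  rw [← planar_eq] at this
  simp only [one_smul, zero_smul, add_zero] at this
  rw [this]; linarith

/-- `θ⁴ / (1 - v²)` at the planar state. -/
def energy (ρ v : ℝ) : ℝ := (ρ ^ 4 * (1 - v ^ 2) ^ 3)⁻¹

theorem energy_pos {ρ v : ℝ} (hρ : 0 < ρ) (hv : v ^ 2 < 1) : 0 < energy ρ v := by
  have : 0 < 1 - v ^ 2 := by linarith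
  unfold energy; positivity

theorem IsFrame.temp_planar_sq {e n : Vec} (h : IsFrame e n) {ρ v : ℝ} (hρ : 0 < ρ)
    (hv : v ^ 2 < 1) : temp (planar e n ρ v) ^ 2 * (ρ ^ 2 * (1 - v ^ 2)) = 1 := by
  have := temp_sq (h.planar_mem hρ hv).1
  rw [h.mink_planar] at this
  linarith

/-- For planar states the Rankine-Hugoniot conditions become the continuity of `energy ρ v * v` and
of `energy ρ v * (1 + 3 * v ^ 2)`. Elimination of the energy leaves `v = v'` or `v * v' = 1 / 3`. -/
theorem IsFrame.flux_planar {e n : Vec} (h : IsFrame e n) {ξ : Vec} {X : ℝ}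
    (hξ : lower ξ = X • n) {ρ v : ℝ} (hρ : 0 < ρ) (hv : v ^ 2 < 1) :
    flux ξ (planar e n ρ v) = X • ((4 / 3 * (energy ρ v * v)) • e +
      (1 / 3 * (energy ρ v * (1 + 3 * v ^ 2))) • n) := by
  funext α
  have h1 := h.temp_planar_sq hρ hv
  set θ := temp (planar e n ρ v) with hθ
  have hv1 : 0 < 1 - v ^ 2 := by linarith
  have hz : mink (vel (planar e n ρ v)) (lower ξ) = θ * ρ * v * X := by
    have := h.mink_comb ρ (ρ * v) 0 X
    rw [← planar_eq, zero_smul, zero_add, ← hξ] at this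
    rw [vel_eq_smul, mink_smul_left, this, ← hθ]; ring
  have hθ2 : θ ^ 2 = (ρ ^ 2 * (1 - v ^ 2))⁻¹ := eq_inv_of_mul_eq_one_left h1
  rw [flux_eq, hz, ← hθ, hξ, vel_eq_smul, ← hθ, planar_eq]
  simp only [Pi.add_apply, Pi.smul_apply, smul_eq_mul, energy]
  have : θ ^ 4 * (4 / 3 * (θ * ρ * v * X) * (θ * (ρ * e α + ρ * v * n α)) + 1 / 3 * (X * n α)) =
    (θ ^ 2) ^ 3 * (4 / 3 * ρ ^ 2 * v * X * (e α + v * n α)) +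
      (θ ^ 2) ^ 2 * (1 / 3 * (X * n α)) := by ring
  rw [this, hθ2]
  field_simp
  ring

theorem flux_neg (ξ ψ : Vec) : flux (-ξ) ψ = -flux ξ ψ := by
  funext α
  simp [flux]

/-- Orthonormal frame adapted to a state and a front through which it moves. -/
theorem exists_frame_of_state {ξ ψ : Vec} (hξ : Spacelike ξ) (hψ : ψ ∈ stateSpace) :
    ∃ (e n : Vec) (X ρ v : ℝ), IsFrame e n ∧ 0 < X ∧ lower ξ = X • n ∧ 0 < ρ ∧ v ^ 2 < 1 ∧
      ψ = planar e n ρ v := by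
  rw [spacelike_iff] at hξ
  obtain ⟨hm, h0⟩ := hψ
  set N := lower ξ with hN
  set X := Real.sqrt (mink N N) with hX
  have hX0 : 0 < X := Real.sqrt_pos.2 hξ
  have hX2 : X ^ 2 = mink N N := Real.sq_sqrt hξ.le
  set s := mink ψ N / X with hs
  have hsX : s * X = mink ψ N := div_mul_cancel₀ _ hX0.ne'
  have hr : 0 < s ^ 2 - mink ψ ψ := by nlinarith [sq_nonneg s]
  set ρ := Real.sqrt (s ^ 2 - mink ψ ψ) with hρ
  have hρ0 : 0 < ρ := Real.sqrt_pos.2 hr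
  have hρ2 : ρ ^ 2 = s ^ 2 - mink ψ ψ := Real.sq_sqrt hr.le
  set n : Vec := X⁻¹ • N with hn
  set e : Vec := ρ⁻¹ • (ψ - s • n) with he
  have hNn : N = X • n := by rw [hn, smul_inv_smul₀ hX0.ne']
  have nn : mink n n = 1 := by
    rw [hn, mink_smul_left, mink_smul_right, ← hX2]; field_simp
  have ψn : mink ψ n = s := by rw [hn, mink_smul_right, hs]; ring
  have en : mink e n = 0 := by
    rw [he, mink_smul_left, mink_sub_left, mink_smul_left, nn, ψn]; ring
  have ee : mink e e = -1 := by
    have : mink (ψ - s • n) (ψ - s • n) = -ρ ^ 2 := by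
      simp only [mink_sub_left, mink_sub_right, mink_smul_left, mink_smul_right, nn,
        mink_comm n ψ, ψn, hρ2]; ring
    rw [he, mink_smul_left, mink_smul_right, this]; field_simp
  have hψe : ψ = ρ • e + s • n := by rw [he, smul_inv_smul₀ hρ0.ne']; simp
  have ψe : mink ψ e = -ρ := by
    rw [he, mink_smul_right, mink_sub_right, mink_smul_right, ψn,
      show mink ψ ψ - s * s = -ρ ^ 2 by rw [hρ2]; ring]
    field_simp
  have fut : 0 < e 0 := time_pos_of_mink_neg hm h0 (by rw [ee]; norm_num) (by rw [ψe]; linarith)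
  refine ⟨e, n, X, ρ, s / ρ, ⟨ee, en, nn, fut⟩, hX0, hNn, hρ0, ?_, ?_⟩
  · rw [div_pow, div_lt_one (by positivity), hρ2]; linarith
  · rw [planar_eq, mul_div_cancel₀ _ hρ0.ne', ← hψe]

/-- The sign of this quantity tells supersonic from subsonic flow through the front. -/
def machSign (ξ ψ : Vec) : ℝ :=
  2 * mink (lower ξ) ψ ^ 2 + mink ψ ψ * mink (lower ξ) (lower ξ)

theorem IsFrame.machSign_planar {e n : Vec} (h : IsFrame e n) {ξ : Vec} {X : ℝ}
    (hξ : lower ξ = X • n) (ρ v : ℝ) :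
    machSign ξ (planar e n ρ v) = (X * ρ) ^ 2 * (3 * v ^ 2 - 1) := by
  have h1 := h.mink_comb 0 X ρ (ρ * v)
  rw [← planar_eq, zero_smul, zero_add, ← hξ] at h1
  rw [machSign, h1, h.mink_planar, hξ, mink_smul_left, mink_smul_right, h.nn]; ring

theorem IsFrame.mink_lower_planar {e n : Vec} (h : IsFrame e n) {ξ : Vec} {X : ℝ}
    (hξ : lower ξ = X • n) (ρ v : ℝ) : mink (lower ξ) (planar e n ρ v) = X * ρ * v := by
  have h1 := h.mink_comb 0 X ρ (ρ * v)
  rw [← planar_eq, zero_smul, zero_add, ← hξ] at h1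
  rw [h1]; ring

theorem IsFrame.comb_inj {e n : Vec} (h : IsFrame e n) {a b c d : ℝ}
    (heq : a • e + b • n = c • e + d • n) : a = c ∧ b = d := by
  have h1 := h.mink_comb a b 1 0
  have h2 := h.mink_comb a b 0 1
  rw [heq, h.mink_comb] at h1 h2
  constructor <;> linarith

/-! ### Structure of Lax shocks. -/

/-- States connected by a shock lie in a common plane; their velocities are conjugate. -/
theorem exists_planar_pair {ξ ψa ψb : Vec} (hξ : Spacelike ξ) (ha : ψa ∈ stateSpace)
    (hb : ψb ∈ stateSpace) (hz : 0 < mink (lower ξ) ψa) (hMa : 0 < machSign ξ ψa)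
    (hMb : machSign ξ ψb < 0) (hRH : flux ξ ψa = flux ξ ψb) :
    ∃ (e n : Vec) (X ρa va ρb vb : ℝ), IsFrame e n ∧ 0 < X ∧ lower ξ = X • n ∧ 0 < ρa ∧ 0 < ρb ∧
      ψa = planar e n ρa va ∧ ψb = planar e n ρb vb ∧ 1 < 3 * va ^ 2 ∧ 0 < va ∧ va < 1 ∧
      0 < vb ∧ va * vb = 1 / 3 ∧ energy ρa va * va = energy ρb vb * vb := by
  obtain ⟨e, n, X, ρa, va, hf, hX, hN, hρa, hva, rfl⟩ := exists_frame_of_state hξ ha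
  rw [hf.mink_lower_planar hN] at hz
  have hva0 : 0 < va := pos_of_mul_pos_right hz (by positivity)
  rw [hf.machSign_planar hN] at hMa
  have hva3 : 0 < 3 * va ^ 2 - 1 := pos_of_mul_pos_right hMa (by positivity)
  -- The flux of the other state is a multiple of that state plus a multiple of `n`. The first
  -- factor cannot vanish, since the common flux has a nonzero component along `e`.
  have hplanar : ∃ x y : ℝ, ψb = x • e + y • n := by
    set τ := mink (vel ψb) (lower ξ) with hτ
    set θ := temp ψb
    have hθ : 0 < θ := temp_pos hb.1
    have hvec : (θ ^ 5 * (4 / 3) * τ) • ψb = (X * (4 / 3 * (energy ρa va * va))) • e +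
        (X * (1 / 3 * (energy ρa va * (1 + 3 * va ^ 2))) - θ ^ 4 * (1 / 3) * X) • n := by
      rw [hf.flux_planar hN hρa hva] at hRH
      funext α
      have := congrFun hRH α
      rw [flux_eq, ← hτ, hN, vel_eq_smul] at this
      simp only [Pi.add_apply, Pi.smul_apply, smul_eq_mul] at this ⊢
      linear_combination -this
    have hk : θ ^ 5 * (4 / 3) * τ ≠ 0 := by
      intro hk
      rw [hk, zero_smul] at hvec
      have h1 := hf.comb_inj ((by simp : (0 : ℝ) • e + (0 : ℝ) • n = 0).trans hvec)
      have := energy_pos hρa hva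
      have : 0 < X * (4 / 3 * (energy ρa va * va)) := by positivity
      linarith [h1.1]
    generalize θ ^ 5 * (4 / 3) * τ = k at hvec hk
    exact ⟨_, _, by rw [← inv_smul_smul₀ hk ψb, hvec, smul_add, smul_smul, smul_smul]⟩
  obtain ⟨x, y, rfl⟩ := hplanar
  have hmb := hb.1
  rw [hf.mink_comb] at hmb
  have hx : 0 < x := by
    by_contra! hx
    have hx' : x ≠ 0 := by rintro rfl; nlinarith [mul_self_nonneg y]
    have h1 : mink (-(x • e + y • n)) (-(x • e + y • n)) < 0 := by
      rw [mink_neg_left, mink_neg_right, neg_neg]; exact hb.1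
    have h2 : mink e (-(x • e + y • n)) < 0 := by
      have := hf.mink_comb 1 0 x y
      simp only [one_smul, zero_smul, add_zero] at this
      rw [mink_neg_right, this]
      have := lt_of_le_of_ne hx hx'
      linarith
    have h3 := time_pos_of_mink_neg (by rw [hf.ee]; norm_num) hf.fut h1 h2
    have h4 := hb.2
    rw [Pi.neg_apply] at h3
    linarith
  have hpl : x • e + y • n = planar e n x (y / x) := by
    rw [planar_eq, mul_div_cancel₀ _ hx.ne']
  rw [hpl] at hMb hRH ⊢
  have hvb : (y / x) ^ 2 < 1 := by
    rw [div_pow, div_lt_one (by positivity)]; linarith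
  set vb := y / x
  rw [hf.machSign_planar hN] at hMb
  have hvb3 : 3 * vb ^ 2 - 1 < 0 := by
    by_contra! hc
    exact absurd hMb (not_lt.2 (by positivity))
  rw [hf.flux_planar hN hρa hva, hf.flux_planar hN hx hvb] at hRH
  obtain ⟨h1, h2⟩ := hf.comb_inj (smul_right_injective Vec hX.ne' hRH)
  have hEa := energy_pos hρa hva
  have hEb := energy_pos hx hvb
  have hE : energy ρa va * va = energy x vb * vb := by linarith
  have hvb0 : 0 < vb := by
    have : 0 < energy x vb * vb := hE ▸ mul_pos hEa hva0
    exact pos_of_mul_pos_right this hEb.le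
  -- The ratio of the two conserved fluxes is `(1 + 3 * v ^ 2) / v`, which takes equal values only
  -- at equal or at conjugate velocities.
  have hconj : (vb - va) * (3 * (va * vb) - 1) = 0 := by
    have h3 : energy ρa va * (1 + 3 * va ^ 2) = energy x vb * (1 + 3 * vb ^ 2) := by linarith
    have h4 : energy ρa va * ((vb - va) * (3 * (va * vb) - 1)) = 0 := by
      linear_combination (-vb) * h3 + (1 + 3 * vb ^ 2) * hE
    exact (mul_eq_zero.1 h4).resolve_left hEa.ne'
  refine ⟨e, n, X, ρa, va, x, vb, hf, hX, hN, hρa, hx, rfl, rfl, by linarith, hva0, by nlinarith,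
    hvb0, ?_, hE⟩
  rcases mul_eq_zero.1 hconj with h | h
  · exfalso
    have : vb = va := by linarith
    rw [this] at hvb3; linarith
  · linarith

/-- The Lax inequalities single out the first and the last characteristic family. -/
theorem IsLaxShock.cases {ξ ψm ψp : Vec} (hξ : Spacelike ξ) (h : IsLaxShock ξ ψm ψp) :
    (0 < mink (lower ξ) ψm ∧ 0 < machSign ξ ψm ∧ machSign ξ ψp < 0) ∨
    (mink (lower ξ) ψp < 0 ∧ 0 < machSign ξ ψp ∧ machSign ξ ψm < 0) := by
  obtain ⟨k, cm, cp, hcm, hcp, hm, hp, h1, h2, h3, h4⟩ := h.lax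
  obtain ⟨rm, wm, sm, Lm, am, bm, hLm, hIm, hwm, hMm⟩ := exists_charSpeeds hξ h.mem_left
  obtain ⟨rp, wp, sp, Lp, ap, bp, hLp, hIp, hwp, hMp⟩ := exists_charSpeeds hξ h.mem_right
  -- The product of the speeds is `r * w ^ 2 * s`, so that its sign is that of `r * s`, and hence of
  -- `machSign`, unless it vanishes. The last clause excludes the two middle families: two negative
  -- and two positive speeds would force `r < 0 < s`, although their product is positive.
  have key : ∀ {ψ c : Vec} {r w s L : ℝ}, r < w → w < s → 0 < L → IsCharSpeeds ξ ψ c →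
      IsCharSpeeds ξ ψ ![r, w, w, s] → L * (r * s) = machSign ξ ψ →
      ((∀ i, 0 < c i) → 0 < w ∧ 0 < machSign ξ ψ) ∧
      ((∀ i, c i < 0) → w < 0 ∧ 0 < machSign ξ ψ) ∧
      (c 0 * c 1 * c 2 * c 3 < 0 → machSign ξ ψ < 0) ∧
      (0 < c 0 * c 1 * c 2 * c 3 → c 1 < 0 → 0 < c 2 → False) := by
    intro ψ c r w s L hr hs hL hc hc' hM
    obtain ⟨i, hi⟩ := hc'.exists_eq hc 0
    obtain ⟨j, hj⟩ := hc'.exists_eq hc 1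
    obtain ⟨l, hl⟩ := hc'.exists_eq hc 3
    replace hi : c i = r := hi
    replace hj : c j = w := hj
    replace hl : c l = s := hl
    have hprod := hc.eq_of_prod hc' 0
    simp only [Fin.prod_univ_four, sub_zero] at hprod
    replace hprod : c 0 * c 1 * c 2 * c 3 = r * w * w * s := hprod
    rw [← hM, hprod]
    refine ⟨fun hpos => ⟨hj ▸ hpos j, ?_⟩, fun hneg => ⟨hj ▸ hneg j, ?_⟩, fun hn => ?_,
      fun hpos h1 h2 => ?_⟩
    · exact mul_pos hL (mul_pos (hi ▸ hpos i) (hl ▸ hpos l))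
    · exact mul_pos hL (mul_pos_of_neg_of_neg (hi ▸ hneg i) (hl ▸ hneg l))
    · refine mul_neg_of_pos_of_neg hL ?_
      by_contra! hc
      nlinarith [mul_nonneg hc (mul_self_nonneg w)]
    · have hrs : 0 < r * s := by
        by_contra! hc
        nlinarith [mul_nonneg (neg_nonneg.2 hc) (mul_self_nonneg w)]
      have hr1 : r ≤ c 1 := by
        obtain ⟨a, ha⟩ := hc.exists_eq hc' 1
        rw [← ha]
        fin_cases a <;> simp <;> linarith
      have hs2 : c 2 ≤ s := by
        obtain ⟨a, ha⟩ := hc.exists_eq hc' 2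
        rw [← ha]
        fin_cases a <;> simp <;> linarith
      nlinarith
  have hm0 := h.mem_left.2
  have hp0 := h.mem_right.2
  obtain ⟨m1, m2, m3, m4⟩ := key am bm hLm hm hIm hMm
  obtain ⟨p1, p2, p3, p4⟩ := key ap bp hLp hp hIp hMp
  have km1 := hcm (by decide : (0 : Fin 4) ≤ 1)
  have km2 := hcm (by decide : (1 : Fin 4) ≤ 2)
  have km3 := hcm (by decide : (2 : Fin 4) ≤ 3)
  have kp1 := hcp (by decide : (0 : Fin 4) ≤ 1)
  have kp2 := hcp (by decide : (1 : Fin 4) ≤ 2)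
  have kp3 := hcp (by decide : (2 : Fin 4) ≤ 3)
  rw [← hwm, ← hwp]
  fin_cases k
  · have b1 := h4 1 (by decide)
    have b2 := h4 2 (by decide)
    have b3 := h4 3 (by decide)
    simp only [Fin.zero_eta] at h2 h3
    obtain ⟨w0, M0⟩ := m1 fun i => h2.trans_le (hcm (Fin.zero_le i))
    refine Or.inl ⟨mul_pos w0 hm0, M0, p3 ?_⟩
    nlinarith [mul_pos b1 (mul_pos b2 b3)]
  -- Here the right state would have two negative and two positive speeds; in the next case it is
  -- the left state.
  · exfalso
    have b2 := h4 2 (by decide)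
    simp only [Fin.mk_one] at h2 h3
    refine p4 ?_ h3 b2
    exact mul_pos (mul_pos (mul_pos_of_neg_of_neg (by linarith) h3) b2) (by linarith)
  · exfalso
    have b1 := h1 1 (by decide)
    simp only [Fin.reduceFinMk] at h2 h3
    refine m4 ?_ b1 h2
    exact mul_pos (mul_pos (mul_pos_of_neg_of_neg (by linarith) b1) h2) (by linarith)
  · have b1 := h1 0 (by decide)
    have b2 := h1 1 (by decide)
    have b3 := h1 2 (by decide)
    simp only [Fin.reduceFinMk] at h2 h3
    obtain ⟨w0, M0⟩ := p2 fun i => (hcp (Fin.le_last i)).trans_lt h3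
    refine Or.inr ⟨mul_neg_of_neg_of_pos w0 hp0, M0, m3 ?_⟩
    exact mul_neg_of_neg_of_pos (mul_neg_of_pos_of_neg (mul_pos_of_neg_of_neg b1 b2) b3) h2

/-! ### Rest points that no solution can leave. -/

/-- A solution of `M(ψ) ψ' = f(ψ)` cannot leave a rest point at which `M` is negative and the
derivative of `f` is positive definite. -/
theorem eq_rest_point_of_tendsto_atBot {V : Type*} [NormedAddCommGroup V] [NormedSpace ℝ V]
    {M : V → V →L[ℝ] V →L[ℝ] ℝ} {f : V → V →L[ℝ] ℝ} {A : V →L[ℝ] V →L[ℝ] ℝ} {p : V}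
    (hM : Tendsto (fun y => ‖M y - M p‖) (𝓝 p) (𝓝 0)) (hf : HasFDerivAt f A p) (hf0 : f p = 0) {c : ℝ} (hc : 0 < c)
    (hsymm : ∀ v w, M p v w = M p w v) (hMc : ∀ w, M p w w ≤ -(c * ‖w‖ ^ 2))
    (hAc : ∀ w, c * ‖w‖ ^ 2 ≤ A w w) {ψ : ℝ → V} (hψ : ∀ x, DifferentiableAt ℝ ψ x)
    (ode : ∀ x, M (ψ x) (deriv ψ x) = f (ψ x)) (hlim : Tendsto ψ atBot (𝓝 p)) (x : ℝ) :
    ψ x = p := by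
  obtain ⟨k, hk0, hk⟩ : ∃ k, 0 < k ∧ ‖A‖ ≤ k := ⟨‖A‖ + 1, by positivity, by linarith⟩
  -- The condition `2 * ε ≤ c` keeps `M` coercive near `p`, with constant `c / 2`. The other one
  -- lets the coercivity of `A` absorb the errors from freezing `M` and from linearising `f`.
  obtain ⟨ε, hε0, hεc, hεk⟩ : ∃ ε, 0 < ε ∧ 2 * ε ≤ c ∧ ε * (1 + 2 * (k + ε) / c) ≤ c := by
    have h1 : Tendsto (fun ε : ℝ => 2 * ε) (𝓝 0) (𝓝 (2 * 0)) := tendsto_id.const_mul 2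
    have h2 : ContinuousAt (fun ε : ℝ => ε * (1 + 2 * (k + ε) / c)) 0 := by fun_prop
    have e1 : ∀ᶠ ε : ℝ in 𝓝[>] 0, 2 * ε < c :=
      (h1.eventually (gt_mem_nhds (by simpa using hc))).filter_mono nhdsWithin_le_nhds
    have e2 : ∀ᶠ ε : ℝ in 𝓝[>] 0, ε * (1 + 2 * (k + ε) / c) < c :=
      (h2.eventually (gt_mem_nhds (by simpa using hc))).filter_mono nhdsWithin_le_nhds
    obtain ⟨ε, h1, h2, h3⟩ := (e1.and (e2.and self_mem_nhdsWithin)).exists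
    exact ⟨ε, h3, h1.le, h2.le⟩
  have hnear : ∀ᶠ y in 𝓝 p, ‖M y - M p‖ ≤ ε ∧ ‖f y - A (y - p)‖ ≤ ε * ‖y - p‖ := by
    refine Filter.Eventually.and ?_ ?_
    · filter_upwards [hM.eventually (gt_mem_nhds hε0)] with y hy using hy.le
    · filter_upwards [hf.isLittleO.bound hε0] with y hy
      simpa [hf0] using hy
  have hdec : ∀ x, (‖M (ψ x) - M p‖ ≤ ε ∧ ‖f (ψ x) - A (ψ x - p)‖ ≤ ε * ‖ψ x - p‖) →
      0 ≤ 2 * M p (deriv ψ x) (ψ x - p) := by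
    rintro x ⟨h1, h2⟩
    set d := ψ x - p
    set w := deriv ψ x
    have hodex := ode x
    have hfn : ‖f (ψ x)‖ ≤ (k + ε) * ‖d‖ := by
      calc ‖f (ψ x)‖ = ‖(f (ψ x) - A d) + A d‖ := by simp
        _ ≤ ε * ‖d‖ + ‖A‖ * ‖d‖ := (norm_add_le _ _).trans (add_le_add h2 (A.le_opNorm d))
        _ ≤ (k + ε) * ‖d‖ := by nlinarith [norm_nonneg d]
    have hMd : ∀ v, |(M (ψ x) - M p) w v| ≤ ε * ‖w‖ * ‖v‖ := fun v =>
      ((M (ψ x) - M p).le_opNorm₂ w v).trans (by gcongr)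
    have hMp : ∀ v, M p w v = f (ψ x) v - (M (ψ x) - M p) w v := fun v => by
      simp [w, ← hodex]
    -- Coercivity of `M (ψ x)` bounds the derivative by the distance to `p`, so that the error from
    -- `M (ψ x) - M p` becomes quadratic in this distance.
    have hw : ‖w‖ ≤ 2 * (k + ε) / c * ‖d‖ := by
      have e1 := hMc w
      have e2 := (abs_le.1 (hMd w)).2
      have e3 : |f (ψ x) w| ≤ (k + ε) * ‖d‖ * ‖w‖ :=
        ((f (ψ x)).le_opNorm w).trans (by gcongr)
      have e4 := (abs_le.1 e3).1
      rw [hMp w] at e1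
      have e5 : c / 2 * ‖w‖ ^ 2 ≤ (k + ε) * ‖d‖ * ‖w‖ := by nlinarith [sq_nonneg ‖w‖]
      rcases (norm_nonneg w).eq_or_lt with h0 | h0
      · rw [← h0]; positivity
      · have : c / 2 * ‖w‖ ≤ (k + ε) * ‖d‖ := by
          refine le_of_mul_le_mul_right ?_ h0
          calc c / 2 * ‖w‖ * ‖w‖ = c / 2 * ‖w‖ ^ 2 := by ring
            _ ≤ _ := e5
        rw [div_mul_eq_mul_div, le_div_iff₀ hc]
        linarith
    have g1 := hAc d
    have g2 : |(f (ψ x) - A d) d| ≤ ε * ‖d‖ * ‖d‖ :=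
      ((f (ψ x) - A d).le_opNorm d).trans (by gcongr)
    have g3 := (abs_le.1 g2).1
    have g4 := (abs_le.1 (hMd d)).2
    have g5 : f (ψ x) d = A d d + (f (ψ x) - A d) d := by simp
    have g6 : ε * ‖w‖ * ‖d‖ ≤ ε * (2 * (k + ε) / c * ‖d‖) * ‖d‖ := by gcongr
    rw [hMp d, g5]
    nlinarith [mul_le_mul_of_nonneg_right hεk (sq_nonneg ‖d‖)]
  -- The form is frozen at `p`, so that no derivative of `M` enters.
  set U : ℝ → ℝ := fun x => M p (ψ x - p) (ψ x - p) with hU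
  have hUd : ∀ x, HasDerivAt U (2 * M p (deriv ψ x) (ψ x - p)) x := by
    intro x
    have h1 := (hψ x).hasDerivAt.sub_const p
    have h2 := ((M p).hasFDerivAt (x := ψ x - p)).comp_hasDerivAt x h1
    refine (h2.clm_apply h1).congr_deriv ?_
    simp only [Function.comp]
    rw [hsymm (ψ x - p) (deriv ψ x)]; ring
  have hUneg : ∀ x, U x ≤ -(c * ‖ψ x - p‖ ^ 2) := fun x => hMc _
  have hψc : Continuous ψ := continuous_iff_continuousAt.2 fun x => (hψ x).continuousAt
  -- along an interval on which the solution stays close, a vanishing start value persists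
  have hstay : ∀ a b, U a = 0 → a ≤ b →
      (∀ y ∈ Set.Icc a b, ‖M (ψ y) - M p‖ ≤ ε ∧ ‖f (ψ y) - A (ψ y - p)‖ ≤ ε * ‖ψ y - p‖) →
      ψ b = p := by
    intro a b ha hab hy
    have hmono : MonotoneOn U (Set.Icc a b) := by
      refine monotoneOn_of_deriv_nonneg (convex_Icc a b)
        (fun y _ => (hUd y).continuousAt.continuousWithinAt)
        (fun y _ => (hUd y).differentiableAt.differentiableWithinAt) fun y hy' => ?_
      rw [(hUd y).deriv]
      exact hdec y (hy y (interior_subset hy'))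
    have h1 := hmono (Set.left_mem_Icc.2 hab) (Set.right_mem_Icc.2 hab) hab
    rw [ha] at h1
    have h2 := hUneg b
    have : ‖ψ b - p‖ ^ 2 ≤ 0 := by
      by_contra! h
      nlinarith [mul_pos hc h]
    have : ‖ψ b - p‖ = 0 := by nlinarith [norm_nonneg (ψ b - p)]
    exact sub_eq_zero.1 (norm_eq_zero.1 this)
  have hUlim : Tendsto U atBot (𝓝 0) := by
    have : Tendsto (fun x => ψ x - p) atBot (𝓝 0) := by simpa using hlim.sub_const p
    have h2 : Continuous fun v : V => M p v v := by fun_prop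
    have h3 := (h2.tendsto 0).comp this
    rwa [map_zero] at h3
  obtain ⟨X, hX⟩ := eventually_atBot.1 (hlim.eventually hnear)
  have hmono : MonotoneOn U (Set.Iic X) := by
    refine monotoneOn_of_deriv_nonneg (convex_Iic X)
      (fun y _ => (hUd y).continuousAt.continuousWithinAt)
      (fun y _ => (hUd y).differentiableAt.differentiableWithinAt) fun y hy' => ?_
    rw [(hUd y).deriv]
    exact hdec y (hX y (interior_subset (s := Set.Iic X) hy'))
  have hleft : ∀ y ≤ X, ψ y = p := by
    intro y hy
    -- `U` tends to `0` at `-∞` and is nondecreasing, whereas it is nonpositive by the sign of `M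
    -- p`.
    have h0 : 0 ≤ U y := by
      refine le_of_tendsto hUlim ?_
      filter_upwards [eventually_le_atBot y] with z hz
      exact hmono (hz.trans hy) hy hz
    have h2 := hUneg y
    have : ‖ψ y - p‖ ^ 2 ≤ 0 := by
      by_contra! h
      nlinarith [mul_pos hc h]
    have : ‖ψ y - p‖ = 0 := by nlinarith [norm_nonneg (ψ y - p)]
    exact sub_eq_zero.1 (norm_eq_zero.1 this)
  rcases le_total x X with hx | hx
  · exact hleft x hx
  -- Continuation to the right: the set where `ψ = p` is closed, and `hstay` extends it beyond each
  -- of its points. No Lipschitz condition on the equation is involved.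
  have hsub : Set.Icc X x ⊆ {y | ψ y = p} := by
    refine IsClosed.Icc_subset_of_forall_exists_gt
      ((isClosed_eq hψc continuous_const).inter isClosed_Icc) (hleft X le_rfl) ?_
    rintro y ⟨hy, -⟩ z hz
    have hy' : ψ y = p := hy
    have hev : ∀ᶠ t in 𝓝 y, ‖M (ψ t) - M p‖ ≤ ε ∧
        ‖f (ψ t) - A (ψ t - p)‖ ≤ ε * ‖ψ t - p‖ :=
      (hψc.tendsto y).eventually (by rw [hy']; exact hnear)
    obtain ⟨δ, hδ, hball⟩ := Metric.eventually_nhds_iff.1 hev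
    have hlt : y < min z (y + δ / 2) := lt_min hz (by linarith)
    refine ⟨min z (y + δ / 2), ?_, hlt, min_le_left _ _⟩
    refine hstay y _ (by simp [hU, hy']) hlt.le fun t ht => hball ?_
    rw [Real.dist_eq, abs_of_nonneg (by linarith [ht.1])]
    linarith [ht.2, min_le_right z (y + δ / 2)]
  exact hsub ⟨hx, le_rfl⟩

/-- A positive definite form on a finite-dimensional space is coercive. -/
theorem exists_coercive {V : Type*} [NormedAddCommGroup V] [NormedSpace ℝ V]
    [FiniteDimensional ℝ V] (G : V →L[ℝ] V →L[ℝ] ℝ) (hG : ∀ w, w ≠ 0 → 0 < G w w) :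
    ∃ c, 0 < c ∧ ∀ w, c * ‖w‖ ^ 2 ≤ G w w := by
  have hcont : Continuous fun w : V => G w w := by fun_prop
  have hcomp : IsCompact (Metric.sphere (0 : V) 1) := by
    have := FiniteDimensional.proper ℝ V
    exact isCompact_sphere 0 1
  rcases (Metric.sphere (0 : V) 1).eq_empty_or_nonempty with hemp | hne
  · refine ⟨1, one_pos, fun w => ?_⟩
    by_cases hw : w = 0
    · simp [hw]
    · exfalso
      have : ‖w‖⁻¹ • w ∈ Metric.sphere (0 : V) 1 := by
        simp [norm_smul, inv_mul_cancel₀ (norm_ne_zero_iff.2 hw)]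
      rw [hemp] at this
      exact this
  · obtain ⟨w₀, hw₀, hmin⟩ := hcomp.exists_isMinOn hne hcont.continuousOn
    have hw0 : w₀ ≠ 0 := by
      rintro rfl
      simp at hw₀
    refine ⟨G w₀ w₀, hG w₀ hw0, fun w => ?_⟩
    by_cases hw : w = 0
    · simp [hw]
    · have hn : ‖w‖ ≠ 0 := norm_ne_zero_iff.2 hw
      have hmem : ‖w‖⁻¹ • w ∈ Metric.sphere (0 : V) 1 := by
        simp [norm_smul, inv_mul_cancel₀ hn]
      have h1 : G w₀ w₀ ≤ G (‖w‖⁻¹ • w) (‖w‖⁻¹ • w) := hmin hmem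
      simp only [map_smul, _root_.smul_apply, smul_eq_mul] at h1
      have h2 : ‖w‖⁻¹ * (‖w‖⁻¹ * G w w) = G w w / ‖w‖ ^ 2 := by field_simp
      rw [h2, le_div_iff₀ (by positivity)] at h1
      exact h1

/-! ### Dissipation and flux Jacobian as quadratic forms. -/

/-- The Minkowski product as a continuous bilinear form. -/
def minkBilin : Vec →L[ℝ] Vec →L[ℝ] ℝ :=
  LinearMap.toContinuousLinearMap
    { toFun := minkForm
      map_add' := fun v w => by ext z; simp [mink_add_left]
      map_smul' := fun a w => by ext z; simp [mink_smul_left] }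

@[simp] theorem minkBilin_apply (v w : Vec) : minkBilin v w = mink v w := rfl

theorem mink_single (w : Vec) (γ : Fin 4) : mink (Pi.single γ 1) w = lower w γ := by
  fin_cases γ <;> simp [mink_eq, lower_zero, lower_of_ne]

theorem continuousAt_vel {ψ : Vec} (h : mink ψ ψ < 0) (α : Fin 4) :
    ContinuousAt (fun φ => vel φ α) ψ := by
  have h1 : ContinuousAt temp ψ := by
    refine ContinuousAt.inv₀ (continuous_mink_self.neg.sqrt.continuousAt) ?_
    exact (Real.sqrt_pos.2 (by linarith)).ne'
  exact h1.mul (continuous_apply α).continuousAt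

theorem continuousAt_B (η μ ν : ℝ) {ψ : Vec} (h : mink ψ ψ < 0) (α β γ δ : Fin 4) :
    ContinuousAt (fun φ => B η μ ν φ α β γ δ) ψ := by
  have h1 := continuousAt_vel h
  have h2 : ∀ α β, ContinuousAt (fun φ => proj φ α β) ψ := fun α β =>
    ((h1 α).mul (h1 β)).add continuousAt_const
  have h3 : ∀ α β, ContinuousAt (fun φ => projMixed φ α β) ψ := fun α β =>
    tendsto_finsetSum _ fun κ _ => (h2 α κ).mul continuousAt_const
  have h4 : ContinuousAt (fun φ => Bvisc φ α β γ δ) ψ :=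
    (((h2 _ _).mul (h2 _ _)).add ((h2 _ _).mul (h2 _ _))).sub
      (continuousAt_const.mul ((h2 _ _).mul (h2 _ _)))
  have h5 : ContinuousAt (fun φ => Bther φ α β γ δ) ψ :=
    (((continuousAt_const.mul (h1 _)).mul (h1 _)).add (h2 _ _)).mul
      (((continuousAt_const.mul (h1 _)).mul (h1 _)).add (h2 _ _))
  have h6 : ContinuousAt (fun φ => Bvelo φ α β γ δ) ψ :=
    tendsto_finsetSum _ fun ε _ =>
      (((h1 α).mul (h3 _ _)).add ((h1 _).mul (h3 _ _))).mul
        (((h1 _).mul (h2 _ _)).add ((h1 _).mul (h2 _ _)))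
  exact ((continuousAt_const.mul h4).sub (continuousAt_const.mul h5)).sub
    (continuousAt_const.mul h6)

/-- The bilinear form of the dissipation. -/
def dissForm (η μ ν : ℝ) (ξ ψ : Vec) : Vec →L[ℝ] Vec →L[ℝ] ℝ :=
  ∑ α, ∑ γ, (∑ β, ∑ δ, ξ β * ξ δ * B η μ ν ψ α β γ δ) •
    (minkForm (Pi.single γ 1)).smulRight (minkForm (Pi.single α 1))

theorem dissForm_apply (η μ ν : ℝ) (ξ ψ v w : Vec) :
    dissForm η μ ν ξ ψ v w = mink (diss η μ ν ξ ψ v) w := by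
  have h : ∀ z : Vec, mink z w = ∑ α, z α * lower w α := by
    intro z; simp [mink_eq, Fin.sum_univ_four, lower_zero, lower_of_ne]
  rw [h]
  simp only [dissForm, _root_.sum_apply, _root_.smul_apply,
    ContinuousLinearMap.smulRight_apply, minkForm_apply, mink_single, smul_eq_mul, diss]
  refine Finset.sum_congr rfl fun α _ => ?_
  rw [Finset.sum_comm, Finset.sum_mul]
  refine Finset.sum_congr rfl fun γ _ => ?_
  simp only [Finset.sum_mul]
  refine Finset.sum_congr rfl fun β _ => Finset.sum_congr rfl fun δ _ => ?_
  ring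

theorem tendsto_norm_sum_smul_sub {X ι E : Type*} [TopologicalSpace X] [Fintype ι]
    [NormedAddCommGroup E] [NormedSpace ℝ E] {m : X → ι → ι → ℝ} (F : ι → ι → E) {x : X}
    (hm : ∀ i j, ContinuousAt (fun y => m y i j) x) :
    Tendsto (fun y => ‖∑ i, ∑ j, m y i j • F i j - ∑ i, ∑ j, m x i j • F i j‖) (𝓝 x) (𝓝 0) :=
  tendsto_iff_norm_sub_tendsto_zero.1 <| tendsto_finsetSum _ fun i _ =>
    tendsto_finsetSum _ fun j _ => (hm i j).tendsto.smul_const _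

theorem tendsto_dissForm_sub (η μ ν : ℝ) (ξ : Vec) {ψ : Vec} (h : mink ψ ψ < 0) :
    Tendsto (fun φ => ‖dissForm η μ ν ξ φ - dissForm η μ ν ξ ψ‖) (𝓝 ψ) (𝓝 0) :=
  tendsto_norm_sum_smul_sub
    (m := fun φ α γ => ∑ β, ∑ δ, ξ β * ξ δ * B η μ ν φ α β γ δ)
    (fun α γ : Fin 4 => (minkForm (Pi.single γ 1)).smulRight (minkForm (Pi.single α 1)))
    fun α γ => tendsto_finsetSum _ fun β _ => tendsto_finsetSum _ fun δ _ =>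
      (tendsto_const_nhds.mul (continuousAt_B η μ ν h α β γ δ))

theorem dissForm_eq (η μ ν : ℝ) (ξ v w : Vec) {ψ : Vec} (hψ : mink ψ ψ < 0)
    {τ b b' P P' K : ℝ} (hτ : τ = mink (vel ψ) (lower ξ)) (hb : b = mink (vel ψ) v)
    (hb' : b' = mink (vel ψ) w) (hP : P = mink (lower ξ) v + τ * b)
    (hP' : P' = mink (lower ξ) w + τ * b') (hK : K = mink (lower ξ) (lower ξ) + τ ^ 2) :
    dissForm η μ ν ξ ψ v w = η * (K * (mink v w + b * b') + P * P' / 3)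
      - μ * ((3 * τ * b + P) * (3 * τ * b' + P'))
      - ν * ((b * K + τ * P) * b' + τ * (b * P' + τ * (mink v w + b * b'))) := by
  rw [dissForm_apply, diss_eq η μ ν ξ v hψ rfl hτ hb hP hK rfl rfl]
  simp only [mink_sub_left, mink_add_left, mink_smul_left, ← hb']
  rw [hP']
  ring

theorem dissForm_symm (η μ ν : ℝ) (ξ v w : Vec) {ψ : Vec} (hψ : mink ψ ψ < 0) :
    dissForm η μ ν ξ ψ v w = dissForm η μ ν ξ ψ w v := by
  rw [dissForm_eq η μ ν ξ v w hψ rfl rfl rfl rfl rfl rfl,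
    dissForm_eq η μ ν ξ w v hψ rfl rfl rfl rfl rfl rfl, mink_comm v w]
  ring

/-- The part of `w` orthogonal to the velocity and to the normal of the front. -/
theorem transversal_nonneg (ξ w : Vec) {ψ : Vec} (hψ : mink ψ ψ < 0) {τ b P κ : ℝ}
    (hτ : τ = mink (vel ψ) (lower ξ)) (hb : b = mink (vel ψ) w)
    (hP : κ * P = mink (lower ξ) w + τ * b) (hκ : 0 < κ)
    (hK : κ ^ 2 = mink (lower ξ) (lower ξ) + τ ^ 2) :
    0 ≤ mink w w + b ^ 2 - P ^ 2 ∧ (w ≠ 0 → b = 0 → P = 0 → 0 < mink w w + b ^ 2 - P ^ 2) := by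
  have hu := mink_vel_self hψ
  set N := lower ξ with hN
  set u := vel ψ with hudef
  -- The vector `N + τ • u` is the projection of the normal to the rest space and has length `κ`.
  -- Thus `P` is the component of `w` along its direction, and `R` is what remains of `w` in the
  -- rest space.
  set R := w + b • u - (P / κ) • (N + τ • u) with hR
  have h1 : mink u R = 0 := by
    rw [hR]
    simp only [mink_add_right, mink_sub_right, mink_smul_right, ← hτ, ← hb, hu]
    ring
  have h2 : mink R R = mink w w + b ^ 2 - P ^ 2 := by
    rw [hR]
    simp only [mink_add_right, mink_sub_right, mink_smul_right, mink_add_left, mink_sub_left,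
      mink_smul_left, mink_comm w u, mink_comm N u, mink_comm w N, ← hτ, ← hb, hu]
    field_simp
    linear_combination 2 * κ * P * hP - P ^ 2 * hK
  have hu' : mink u u < 0 := by rw [hu]; norm_num
  constructor
  · rw [← h2]
    by_cases hR0 : R = 0
    · rw [hR0]; simp [mink_eq]
    · exact (mink_self_pos_of_orthogonal hu' hR0 h1).le
  · intro hw hb0 hP0
    rw [← h2]
    refine mink_self_pos_of_orthogonal hu' ?_ h1
    rw [hR, hb0, hP0]
    simpa using hw

/-- `κ` is the length of the projection of the normal to the rest space of the fluid. In this scale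
the quadratic forms below depend on the front only through `v`. -/
theorem IsFrame.vel_planar_data {e n : Vec} (h : IsFrame e n) {ξ : Vec} {X : ℝ}
    (hX : 0 < X) (hξ : lower ξ = X • n) {ρ v : ℝ} (hρ : 0 < ρ) (hv : v ^ 2 < 1) :
    ∃ κ, 0 < κ ∧ mink (vel (planar e n ρ v)) (lower ξ) = κ * v ∧
      κ ^ 2 = mink (lower ξ) (lower ξ) + (κ * v) ^ 2 := by
  have h1 := h.temp_planar_sq hρ hv
  set θ := temp (planar e n ρ v) with hθ
  have hθ0 : 0 < θ := temp_pos (h.planar_mem hρ hv).1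
  refine ⟨X * θ * ρ, by positivity, ?_, ?_⟩
  · rw [vel_eq_smul, mink_smul_left, mink_comm, h.mink_lower_planar hξ, ← hθ]; ring
  · rw [hξ, mink_smul_left, mink_smul_right, h.nn]
    linear_combination X ^ 2 * h1

/-- Split `w` into `b` along the velocity, `P` along the projected normal and a transversal part of
square `q`. The negative of the form is `κ ^ 2` times `(ν v² - η) q` plus a binary form in `b`, `P`.
The hypotheses `h1`, `h2`, `h3` are the positivity of the first coefficient and of the leading
coefficient and determinant of the binary form. -/
theorem dissForm_neg {η μ ν : ℝ} (ξ : Vec) {ψ : Vec} (hψ : mink ψ ψ < 0) {κ v : ℝ}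
    (hκ : 0 < κ) (hτ : mink (vel ψ) (lower ξ) = κ * v)
    (hK : κ ^ 2 = mink (lower ξ) (lower ξ) + (κ * v) ^ 2) (h1 : η < ν * v ^ 2)
    (h2 : 0 < 9 * μ * v ^ 2 + ν)
    (h3 : (3 * μ * v + ν * v) ^ 2 < (9 * μ * v ^ 2 + ν) * (μ + ν * v ^ 2 - 4 / 3 * η))
    {w : Vec} (hw : w ≠ 0) : dissForm η μ ν ξ ψ w w < 0 := by
  set b := mink (vel ψ) w with hb
  set P := (mink (lower ξ) w + κ * v * b) / κ with hP
  have hP' : κ * P = mink (lower ξ) w + κ * v * b := mul_div_cancel₀ _ hκ.ne'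
  obtain ⟨hq, hq'⟩ := transversal_nonneg ξ w hψ hτ.symm hb hP' hκ hK
  rw [dissForm_eq η μ ν ξ w w hψ hτ.symm hb hb hP' hP' hK]
  set q := mink w w + b ^ 2 - P ^ 2 with hqdef
  have hww : mink w w = q - b ^ 2 + P ^ 2 := by rw [hqdef]; ring
  rw [hww]
  have key : η * (κ ^ 2 * (q - b ^ 2 + P ^ 2 + b * b) + κ * P * (κ * P) / 3) -
      μ * ((3 * (κ * v) * b + κ * P) * (3 * (κ * v) * b + κ * P)) -
      ν * ((b * κ ^ 2 + κ * v * (κ * P)) * b +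
        κ * v * (b * (κ * P) + κ * v * (q - b ^ 2 + P ^ 2 + b * b))) =
      -(κ ^ 2 * ((ν * v ^ 2 - η) * q + ((9 * μ * v ^ 2 + ν) * b ^ 2 +
        2 * (3 * μ * v + ν * v) * (b * P) + (μ + ν * v ^ 2 - 4 / 3 * η) * P ^ 2))) := by ring
  rw [key]
  refine neg_neg_of_pos (mul_pos (by positivity) ?_)
  set a := 9 * μ * v ^ 2 + ν
  set d := 3 * μ * v + ν * v
  set c := μ + ν * v ^ 2 - 4 / 3 * η
  have hquad : a * (a * b ^ 2 + 2 * d * (b * P) + c * P ^ 2) =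
      (a * b + d * P) ^ 2 + (a * c - d ^ 2) * P ^ 2 := by ring
  have hD : 0 < a * c - d ^ 2 := by linarith
  have hnn : 0 ≤ a * b ^ 2 + 2 * d * (b * P) + c * P ^ 2 := by
    refine nonneg_of_mul_nonneg_right ?_ h2
    rw [hquad]; positivity
  have hη : 0 < ν * v ^ 2 - η := by linarith
  by_cases hP0 : P = 0
  · by_cases hb0 : b = 0
    · have := hq' hw hb0 hP0
      exact add_pos_of_pos_of_nonneg (mul_pos hη this) hnn
    · refine add_pos_of_nonneg_of_pos (mul_nonneg hη.le hq) ?_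
      rw [hP0]
      have : 0 < a * b ^ 2 := by positivity
      simpa using this
  · refine add_pos_of_nonneg_of_pos (mul_nonneg hη.le hq) ?_
    refine pos_of_mul_pos_right ?_ h2.le
    rw [hquad]
    positivity

/-- In the same splitting the form is a positive multiple of `3 v b² + 2 b P + v P² + v q`. Its
determinant in `b`, `P` is `3 v² - 1`: the Jacobian is definite since the flow is supersonic. -/
theorem mink_fluxDeriv_pos (ξ : Vec) {ψ : Vec} (hψ : mink ψ ψ < 0) {κ v : ℝ}
    (hκ : 0 < κ) (hτ : mink (vel ψ) (lower ξ) = κ * v)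
    (hK : κ ^ 2 = mink (lower ξ) (lower ξ) + (κ * v) ^ 2) (hv : 0 < v) (hv3 : 1 < 3 * v ^ 2)
    {w : Vec} (hw : w ≠ 0) : 0 < mink (fluxDeriv ξ ψ w) w := by
  set b := mink (vel ψ) w with hb
  set P := (mink (lower ξ) w + κ * v * b) / κ with hP
  have hP' : κ * P = mink (lower ξ) w + κ * v * b := mul_div_cancel₀ _ hκ.ne'
  obtain ⟨hq, hq'⟩ := transversal_nonneg ξ w hψ hτ.symm hb hP' hκ hK
  set q := mink w w + b ^ 2 - P ^ 2 with hqdef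
  have hww : mink w w = q - b ^ 2 + P ^ 2 := by rw [hqdef]; ring
  have hNw : mink (lower ξ) w = κ * P - κ * v * b := by linarith
  have hθ := temp_pos hψ
  set θ := temp ψ with hθdef
  have hb' : b = θ * mink ψ w := by rw [hb, vel_eq_smul, mink_smul_left]
  have hτ' : κ * v = θ * mink (lower ξ) ψ := by
    rw [← hτ, vel_eq_smul, mink_smul_left, mink_comm]
  have key : mink (fluxDeriv ξ ψ w) w = 4 / 3 * θ ^ 5 * κ *
      (3 * v * b ^ 2 + 2 * (b * P) + v * P ^ 2 + v * q) := by
    simp only [fluxDeriv, mink_smul_left, mink_add_left, hww, hNw]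
    rw [← hθdef]
    have e1 : mink ψ w = b / θ := by rw [hb']; field_simp
    have e2 : mink (lower ξ) ψ = κ * v / θ := by rw [hτ']; field_simp
    rw [e1, e2]
    field_simp
    ring
  rw [key]
  refine mul_pos (by positivity) ?_
  have hquad : v * (3 * v * b ^ 2 + 2 * (b * P) + v * P ^ 2) =
      (b + v * P) ^ 2 + (3 * v ^ 2 - 1) * b ^ 2 := by ring
  have h3 : 0 < 3 * v ^ 2 - 1 := by linarith
  have hnn : 0 ≤ 3 * v * b ^ 2 + 2 * (b * P) + v * P ^ 2 := by
    refine nonneg_of_mul_nonneg_right ?_ hv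
    rw [hquad]; positivity
  by_cases hb0 : b = 0
  · by_cases hP0 : P = 0
    · have := hq' hw hb0 hP0
      exact add_pos_of_nonneg_of_pos hnn (mul_pos hv this)
    · refine add_pos_of_pos_of_nonneg ?_ (mul_nonneg hv.le hq)
      rw [hb0]
      have : 0 < v * P ^ 2 := by positivity
      simpa using this
  · refine add_pos_of_pos_of_nonneg ?_ (mul_nonneg hv.le hq)
    refine pos_of_mul_pos_right ?_ hv.le
    rw [hquad]
    positivity

/-- Nothing leaves a supersonic state that is faster than all dissipative signals. -/
theorem not_hasProfile {η μ ν : ℝ} {ξ ψm ψp : Vec} (hψ : mink ψm ψm < 0) (hne : ψm ≠ ψp)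
    (hneg : ∀ w, w ≠ 0 → dissForm η μ ν ξ ψm w w < 0)
    (hpos : ∀ w, w ≠ 0 → 0 < mink (fluxDeriv ξ ψm w) w) : ¬ HasProfile η μ ν ξ ψm ψp := by
  rintro ⟨ψ, hprof⟩
  obtain ⟨L, hL, hLw⟩ := hasFDerivAt_flux ξ hψ
  set A : Vec →L[ℝ] Vec →L[ℝ] ℝ := minkBilin ∘L L
  have hA : ∀ v w, A v w = mink (fluxDeriv ξ ψm v) w := fun v w => by simp [A, hLw]
  obtain ⟨c₁, hc₁, h1⟩ := exists_coercive A fun w hw => by rw [hA]; exact hpos w hw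
  obtain ⟨c₂, hc₂, h2⟩ := exists_coercive (-dissForm η μ ν ξ ψm) fun w hw => by
    simpa using hneg w hw
  set f : Vec → Vec →L[ℝ] ℝ := fun φ => minkBilin (flux ξ φ - flux ξ ψm)
  have hf : HasFDerivAt f A ψm := minkBilin.hasFDerivAt.comp ψm (hL.sub_const _)
  have hconst := eq_rest_point_of_tendsto_atBot (M := dissForm η μ ν ξ) (f := f) (A := A)
    (tendsto_dissForm_sub η μ ν ξ hψ) hf (by simp [f]) (lt_min hc₁ hc₂)
    (fun v w => dissForm_symm η μ ν ξ v w hψ)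
    (fun w => ?_) (fun w => ?_) (fun x => (hprof.contDiff.differentiable (by norm_num)) x)
    (fun x => ?_) hprof.tendsto_left
  · refine hne (tendsto_nhds_unique ?_ hprof.tendsto_right)
    rw [show ψ = fun _ => ψm from funext hconst]
    exact tendsto_const_nhds
  · have := h2 w
    simp only [_root_.neg_apply] at this
    nlinarith [mul_le_mul_of_nonneg_right (min_le_right c₁ c₂) (sq_nonneg ‖w‖)]
  · exact (mul_le_mul_of_nonneg_right (min_le_left c₁ c₂) (sq_nonneg ‖w‖)).trans (h1 w)
  · ext w
    rw [dissForm_apply]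
    have : diss η μ ν ξ (ψ x) (deriv ψ x) = flux ξ (ψ x) - flux ξ ψm := by
      funext α; exact hprof.ode x α
    rw [this]
    rfl

/-! ### Shocks without a profile. -/

theorem exists_frame {ξ : Vec} (hξ : Spacelike ξ) :
    ∃ (e n : Vec) (X : ℝ), IsFrame e n ∧ 0 < X ∧ lower ξ = X • n := by
  have hdt : dt ∈ stateSpace := by
    constructor
    · simp [mink_eq, dt]
    · simp [dt]
  obtain ⟨e, n, X, -, -, hf, hX, hN, -⟩ := exists_frame_of_state hξ hdt
  exact ⟨e, n, X, hf, hX, hN⟩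

theorem exists_energy_eq {a v : ℝ} (ha : 0 < a) (hv : v ^ 2 < 1) :
    ∃ ρ, 0 < ρ ∧ energy ρ v = a := by
  have h1 : 0 < 1 - v ^ 2 := by linarith
  set y := (a * (1 - v ^ 2) ^ 3)⁻¹ with hy
  have hy0 : 0 < y := by positivity
  refine ⟨Real.sqrt (Real.sqrt y), by positivity, ?_⟩
  have : Real.sqrt (Real.sqrt y) ^ 4 = y := by
    rw [show Real.sqrt (Real.sqrt y) ^ 4 = (Real.sqrt (Real.sqrt y) ^ 2) ^ 2 by ring,
      Real.sq_sqrt (by positivity), Real.sq_sqrt hy0.le]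
  rw [energy, this, hy]
  field_simp

/-- Converse of `exists_planar_pair`. Since `v` is positive on both sides, the speed of the fluid
and the faster acoustic speed are positive. The slowest speed then has the sign of `3 * v ^ 2 - 1`,
so that exactly this one changes sign across the front. -/
theorem isLaxShock_of_conjugate {e n ξ : Vec} {X : ℝ} (hf : IsFrame e n) (hξ : Spacelike ξ)
    (hX : 0 < X) (hN : lower ξ = X • n) {ρa va ρb vb : ℝ} (hρa : 0 < ρa) (hρb : 0 < ρb)
    (hva : 1 < 3 * va ^ 2) (hva0 : 0 < va) (hva1 : va < 1) (hvb0 : 0 < vb)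
    (hvv : va * vb = 1 / 3) (hE : energy ρa va * va = energy ρb vb * vb) :
    IsLaxShock ξ (planar e n ρa va) (planar e n ρb vb) := by
  have hva2 : va ^ 2 < 1 := by nlinarith
  have hvb3 : 3 * vb ^ 2 < 1 := by
    have h1 : 3 * va ^ 2 * (3 * vb ^ 2) = 1 := by
      rw [show 3 * va ^ 2 * (3 * vb ^ 2) = 9 * (va * vb) ^ 2 by ring, hvv]; norm_num
    have : 0 < vb ^ 2 := by positivity
    nlinarith
  have hvb2 : vb ^ 2 < 1 := by linarith [sq_nonneg vb]
  have hma := hf.planar_mem hρa hva2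
  have hmb := hf.planar_mem hρb hvb2
  refine ⟨hma, hmb, ?_, ?_⟩
  · rw [hf.flux_planar hN hρa hva2, hf.flux_planar hN hρb hvb2, hE]
    have : energy ρa va * (1 + 3 * va ^ 2) = energy ρb vb * (1 + 3 * vb ^ 2) := by
      linear_combination (-3 * energy ρa va + 3 * energy ρb vb) * hvv + 3 * (va + vb) * hE
    rw [this]
  · obtain ⟨r, w, s, L, h1, h2, hL, hI, hw, hM⟩ := exists_charSpeeds hξ hma
    obtain ⟨r', w', s', L', h1', h2', hL', hI', hw', hM'⟩ := exists_charSpeeds hξ hmb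
    have hMa : L * (r * s) = _ := hM.trans (hf.machSign_planar hN ρa va)
    have hMb : L' * (r' * s') = _ := hM'.trans (hf.machSign_planar hN ρb vb)
    rw [hf.mink_lower_planar hN] at hw hw'
    have hw0 : 0 < w := by
      have : 0 < w * planar e n ρa va 0 := by rw [hw]; positivity
      exact pos_of_mul_pos_left this hma.2.le
    have hw0' : 0 < w' := by
      have : 0 < w' * planar e n ρb vb 0 := by rw [hw']; positivity
      exact pos_of_mul_pos_left this hmb.2.le
    have hrs : 0 < r * s := by
      have : 0 < L * (r * s) := by
        rw [hMa]; exact mul_pos (by positivity) (by linarith)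
      exact pos_of_mul_pos_right this hL.le
    have hrs' : r' * s' < 0 := by
      have : L' * (r' * s') < 0 := by
        rw [hMb]; exact mul_neg_of_pos_of_neg (by positivity) (by linarith)
      by_contra! h
      exact absurd this (not_lt.2 (mul_nonneg hL'.le h))
    have hr0 : 0 < r := pos_of_mul_pos_left hrs (hw0.trans h2).le
    have hr0' : r' < 0 := by
      by_contra! h
      exact absurd hrs' (not_lt.2 (mul_nonneg h (hw0'.trans h2').le))
    have hmono : ∀ {r w s : ℝ}, r < w → w < s → Monotone (![r, w, w, s] : Vec) := by
      intro r w s h1 h2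
      refine Fin.monotone_iff_le_succ.2 fun i => ?_
      fin_cases i
      · exact h1.le
      · exact le_rfl
      · exact h2.le
    refine ⟨0, _, _, hmono h1 h2, hmono h1' h2', hI, hI', fun i hi => absurd hi (Fin.not_lt_zero i),
      hr0, hr0', fun i hi => ?_⟩
    fin_cases i
    · exact absurd hi (lt_irrefl _)
    · exact hw0'
    · exact hw0'
    · exact hw0'.trans h2'

/-- Under strict causality, strong shocks have no dissipation profile. -/
theorem exists_shock_without_profile {η μ ν : ℝ} (hη : 0 < η) (hμ : 4 / 3 * η ≤ μ)
    (hν : (1 / (3 * η) - 1 / (9 * μ))⁻¹ < ν) {ξ : Vec} (hξ : Spacelike ξ) :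
    ∃ ψm ψp : Vec, IsLaxShock ξ ψm ψp ∧ ¬ HasProfile η μ ν ξ ψm ψp := by
  have hμ0 : 0 < μ := by linarith
  have h3μ : 0 < 3 * μ - η := by linarith
  have hνe : 9 * η * μ < ν * (3 * μ - η) := by
    have : (1 / (3 * η) - 1 / (9 * μ))⁻¹ = 9 * η * μ / (3 * μ - η) := by
      have : 1 / (3 * η) - 1 / (9 * μ) = (3 * μ - η) / (9 * η * μ) := by field_simp; ring
      rw [this, inv_div]
    rwa [this, div_lt_iff₀ h3μ] at hν
  have hν0 : 0 < ν := by
    refine pos_of_mul_pos_left (lt_trans ?_ hνe) h3μ.le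
    positivity
  have hην : η < ν := by
    by_contra! h
    nlinarith [mul_le_mul_of_nonneg_right h h3μ.le]
  -- All strict inequalities other than `v < 1` hold at `v = 1` and persist slightly below it. At `v
  -- = 1` the second one reduces to `9 η μ < ν (3 μ - η)`, which is strict causality with the
  -- denominators cleared.
  obtain ⟨v, h1, h2, h3, hv3, hv1, hv0⟩ : ∃ v : ℝ, η < ν * v ^ 2 ∧
      (3 * μ * v + ν * v) ^ 2 < (9 * μ * v ^ 2 + ν) * (μ + ν * v ^ 2 - 4 / 3 * η) ∧
      0 < 9 * μ * v ^ 2 + ν ∧ 1 < 3 * v ^ 2 ∧ v < 1 ∧ 0 < v := by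
    have c1 : ContinuousAt (fun v : ℝ => ν * v ^ 2) 1 := by fun_prop
    have c2 : ContinuousAt (fun v : ℝ =>
      (9 * μ * v ^ 2 + ν) * (μ + ν * v ^ 2 - 4 / 3 * η) - (3 * μ * v + ν * v) ^ 2) 1 := by fun_prop
    have c3 : ContinuousAt (fun v : ℝ => 3 * v ^ 2) 1 := by fun_prop
    have e1 := c1.eventually (lt_mem_nhds (by simpa using hην))
    have e2 := c2.eventually (lt_mem_nhds (a := 0) (by nlinarith))
    have e3 := c3.eventually (lt_mem_nhds (a := 1) (by norm_num))
    have e4 := lt_mem_nhds (zero_lt_one' ℝ)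
    obtain ⟨v, ⟨f1, f2, f3, f4⟩, f5⟩ :=
      (((e1.and (e2.and (e3.and e4))).filter_mono nhdsWithin_le_nhds).and
        (self_mem_nhdsWithin : Set.Iio (1 : ℝ) ∈ 𝓝[<] 1)).exists
    exact ⟨v, f1, by linarith, by positivity, f3, f5, f4⟩
  have hv2 : v ^ 2 < 1 := by nlinarith
  obtain ⟨e, n, X, hf, hX, hN⟩ := exists_frame hξ
  have hvb0 : 0 < 1 / (3 * v) := by positivity
  have hvv : v * (1 / (3 * v)) = 1 / 3 := by field_simp
  have hvb2 : (1 / (3 * v)) ^ 2 < 1 := by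
    rw [div_pow, div_lt_one (by positivity)]
    nlinarith
  have hE1 := energy_pos one_pos hv2
  obtain ⟨ρ, hρ, hE⟩ := exists_energy_eq
    (a := energy 1 v * v / (1 / (3 * v))) (by positivity) hvb2
  have hE' : energy 1 v * v = energy ρ (1 / (3 * v)) * (1 / (3 * v)) := by
    rw [hE, div_mul_cancel₀ _ hvb0.ne']
  refine ⟨planar e n 1 v, planar e n ρ (1 / (3 * v)),
    isLaxShock_of_conjugate hf hξ hX hN one_pos hρ hv3 hv0 hv1 hvb0 hvv hE', ?_⟩
  have hm := (hf.planar_mem one_pos hv2).1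
  obtain ⟨κ, hκ, hτ, hK⟩ := hf.vel_planar_data hX hN one_pos hv2
  refine not_hasProfile hm ?_ (fun w hw => dissForm_neg ξ hm hκ hτ hK h1 h3 h2 hw)
    (fun w hw => mink_fluxDeriv_pos ξ hm hκ hτ hK hv0 hv3 hw)
  intro heq
  rw [planar_eq, planar_eq] at heq
  obtain ⟨i1, i2⟩ := hf.comb_inj heq
  rw [← i1, one_mul, one_mul] at i2
  rw [← i2] at hvv
  nlinarith

/-! ### Bounded solutions of scalar equations and change of time. -/

open MeasureTheory Set in
/-- The bounded solution of `y' = h - lam y`. -/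
def expAverage (lam : ℝ) (h : ℝ → ℝ) (t : ℝ) : ℝ :=
  Real.exp (-(lam * t)) * ∫ s in Iic t, Real.exp (lam * s) * h s

section expAverage
open MeasureTheory Set

theorem integrableOn_exp_mul_bounded {lam C : ℝ} (hlam : 0 < lam) {h : ℝ → ℝ} (hc : Continuous h)
    (hb : ∀ s, |h s| ≤ C) (t : ℝ) : IntegrableOn (fun s => Real.exp (lam * s) * h s) (Iic t) :=
  (integrableOn_exp_mul_Iic hlam t).mul_bdd (c := C) hc.aestronglyMeasurable
    (Eventually.of_forall hb)

theorem hasDerivAt_expAverage {lam C : ℝ} (hlam : 0 < lam) {h : ℝ → ℝ} (hc : Continuous h)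
    (hb : ∀ s, |h s| ≤ C) (t : ℝ) :
    HasDerivAt (expAverage lam h) (h t - lam * expAverage lam h t) t := by
  have hint := integrableOn_exp_mul_bounded hlam hc hb
  have hcont : Continuous fun s => Real.exp (lam * s) * h s := by fun_prop
  have h1 : HasDerivAt (fun t => ∫ s in Iic t, Real.exp (lam * s) * h s)
      (Real.exp (lam * t) * h t) t := by
    have : (fun t => ∫ s in Iic t, Real.exp (lam * s) * h s) = fun t =>
        (∫ s in Iic 0, Real.exp (lam * s) * h s) + ∫ s in (0 : ℝ)..t, Real.exp (lam * s) * h s := by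
      funext t
      rw [← intervalIntegral.integral_Iic_sub_Iic (hint 0) (hint t)]; ring
    rw [this]
    exact (hcont.integral_hasStrictDerivAt 0 t).hasDerivAt.const_add _
  have h2 : HasDerivAt (fun t => Real.exp (-(lam * t))) (Real.exp (-(lam * t)) * -(lam * 1)) t :=
    (((hasDerivAt_id t).const_mul lam).neg).exp
  refine (h2.mul h1).congr_deriv ?_
  have h3 : Real.exp (-(lam * t)) * Real.exp (lam * t) = 1 := by
    rw [← Real.exp_add]; simp
  rw [expAverage]
  linear_combination h t * h3

/-- The kernel `exp (-lam (t - s))` on `s ≤ t` is positive and has mass `1 / lam`. Comparison with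
zero gives the invariance of a strip, comparison of two right-hand sides the contraction. -/
theorem expAverage_le {lam C D : ℝ} (hlam : 0 < lam) {h k : ℝ → ℝ} (hc : Continuous h)
    (hb : ∀ s, |h s| ≤ C) (kc : Continuous k) (kb : ∀ s, |k s| ≤ C) (hle : ∀ s, h s ≤ k s + D)
    (t : ℝ) : expAverage lam h t ≤ expAverage lam k t + D / lam := by
  have hint := integrableOn_exp_mul_bounded hlam hc hb t
  have kint := integrableOn_exp_mul_bounded hlam kc kb t
  have dint : IntegrableOn (fun s => Real.exp (lam * s) * D) (Iic t) :=
    (integrableOn_exp_mul_Iic hlam t).mul_const D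
  have h1 : ∫ s in Iic t, Real.exp (lam * s) * h s ≤
      (∫ s in Iic t, Real.exp (lam * s) * k s) + ∫ s in Iic t, Real.exp (lam * s) * D := by
    rw [← integral_add kint dint]
    refine integral_mono hint (kint.add dint) fun s => ?_
    have := mul_le_mul_of_nonneg_left (hle s) (Real.exp_pos (lam * s)).le
    linarith
  rw [integral_mul_const, integral_exp_mul_Iic hlam] at h1
  have h3 : Real.exp (-(lam * t)) * Real.exp (lam * t) = 1 := by
    rw [← Real.exp_add]; simp
  have h4 := mul_le_mul_of_nonneg_left h1 (Real.exp_pos (-(lam * t))).le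
  unfold expAverage
  refine h4.trans_eq ?_
  linear_combination D / lam * h3

theorem expAverage_zero (lam t : ℝ) : expAverage lam (fun _ => 0) t = 0 := by
  simp [expAverage]

end expAverage

/-- A scalar equation `y' = R(t, y) - lam y` with a small Lipschitz constant of `R` has a solution
on the whole line within an invariant strip. -/
theorem exists_solution_in_strip {lam m : ℝ} (hlam : 0 < lam) (hm : 0 ≤ m) {R : ℝ → ℝ → ℝ}
    (hR : ContinuousOn (Function.uncurry R) (Set.univ ×ˢ Set.Icc 0 m))
    (hR0 : ∀ t, ∀ y ∈ Set.Icc 0 m, 0 ≤ R t y ∧ R t y ≤ lam * m)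
    (hL : ∀ t, ∀ y ∈ Set.Icc 0 m, ∀ z ∈ Set.Icc 0 m, |R t y - R t z| ≤ lam / 2 * |y - z|) :
    ∃ y : ℝ → ℝ, (∀ t, y t ∈ Set.Icc 0 m) ∧ ∀ t, HasDerivAt y (R t (y t) - lam * y t) t := by
  -- Truncation to the strip makes the map defined on all bounded continuous functions. It is
  -- inactive on the fixed point, whose values lie in the strip.
  set pr : ℝ → ℝ := fun y => (Set.projIcc 0 m hm y : ℝ) with hpr
  have prc : Continuous pr := continuous_subtype_val.comp continuous_projIcc
  have prm : ∀ y, pr y ∈ Set.Icc 0 m := fun y => (Set.projIcc 0 m hm y).2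
  have prl : ∀ y z, |pr y - pr z| ≤ |y - z| := fun y z => by
    have := LipschitzWith.projIcc hm |>.dist_le_mul y z
    rwa [NNReal.coe_one, one_mul, Subtype.dist_eq, Real.dist_eq, Real.dist_eq] at this
  set h : BoundedContinuousFunction ℝ ℝ → ℝ → ℝ := fun f s => R s (pr (f s)) with hh
  have hc : ∀ f, Continuous (h f) := fun f =>
    hR.comp_continuous (f := fun s => (s, pr (f s)))
      (continuous_id.prodMk (prc.comp f.continuous)) fun s => ⟨trivial, prm _⟩
  have hb : ∀ f s, |h f s| ≤ lam * m := fun f s => by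
    obtain ⟨h1, h2⟩ := hR0 s _ (prm (f s))
    rw [hh, abs_of_nonneg h1]; exact h2
  have zb : ∀ s : ℝ, |(fun _ : ℝ => (0 : ℝ)) s| ≤ lam * m := fun s => by
    simpa using mul_nonneg hlam.le hm
  have hmem : ∀ f t, expAverage lam (h f) t ∈ Set.Icc 0 m := by
    intro f t
    constructor
    · have := expAverage_le (D := 0) hlam continuous_const zb (hc f) (hb f)
        (fun s => by simpa using (hR0 s _ (prm (f s))).1) t
      rw [expAverage_zero] at this
      simpa using this
    · have := expAverage_le (D := lam * m) hlam (hc f) (hb f) continuous_const zb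
        (fun s => by simpa using (hR0 s _ (prm (f s))).2) t
      rw [expAverage_zero] at this
      rwa [zero_add, mul_div_cancel_left₀ _ hlam.ne'] at this
  have hder := fun f t => hasDerivAt_expAverage hlam (hc f) (hb f) t
  let Φ : BoundedContinuousFunction ℝ ℝ → BoundedContinuousFunction ℝ ℝ := fun f =>
    BoundedContinuousFunction.ofNormedAddCommGroup (expAverage lam (h f))
      (continuous_iff_continuousAt.2 fun t => (hder f t).continuousAt) m fun t => by
        rw [Real.norm_eq_abs, abs_of_nonneg (hmem f t).1]; exact (hmem f t).2
  -- The Lipschitz constant `lam / 2` times the mass `1 / lam` of the kernel.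
  have hΦ : ContractingWith (1 / 2) Φ := by
    refine ⟨by rw [div_lt_one] <;> norm_num, LipschitzWith.of_dist_le_mul fun f k => ?_⟩
    refine (BoundedContinuousFunction.dist_le (by positivity)).2 fun t => ?_
    have hfk : ∀ s, |h f s - h k s| ≤ lam / 2 * dist f k := fun s =>
      (hL s _ (prm _) _ (prm _)).trans (mul_le_mul_of_nonneg_left
        ((prl _ _).trans (by rw [← Real.dist_eq]; exact f.dist_coe_le_dist s)) (by positivity))
    have e1 := expAverage_le (D := lam / 2 * dist f k) hlam (hc f) (hb f) (hc k) (hb k)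
      (fun s => by linarith [(abs_le.1 (hfk s)).2]) t
    have e2 := expAverage_le (D := lam / 2 * dist f k) hlam (hc k) (hb k) (hc f) (hb f)
      (fun s => by linarith [(abs_le.1 (hfk s)).1]) t
    have e3 : lam / 2 * dist f k / lam = 1 / 2 * dist f k := by field_simp
    rw [e3] at e1 e2
    change |expAverage lam (h f) t - expAverage lam (h k) t| ≤ _
    rw [abs_le]
    push_cast
    constructor <;> linarith
  set f := ContractingWith.fixedPoint Φ hΦ
  have hfix : Φ f = f := ContractingWith.fixedPoint_isFixedPt hΦ
  have hval : ∀ t, expAverage lam (h f) t = f t := fun t => by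
    conv_rhs => rw [← hfix]
    rfl
  refine ⟨expAverage lam (h f), hmem f, fun t => ?_⟩
  refine (hder f t).congr_deriv ?_
  have : pr (f t) = expAverage lam (h f) t := by
    rw [← hval, hpr]
    simp only [Set.projIcc_of_mem hm (hmem f t)]
  rw [hh] at this ⊢
  simp only [this]

/-- The autonomous reparametrisation of time with a prescribed bounded positive rate. -/
theorem exists_time_change {p : ℝ → ℝ} (hp : Continuous p) (hp0 : ∀ t, 0 < p t) {C : ℝ}
    (hC : ∀ t, p t ≤ C) : ∃ τ : ℝ → ℝ, (∀ x, HasDerivAt τ (p (τ x)) x) ∧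
      Tendsto τ atTop atTop ∧ Tendsto τ atBot atBot := by
  have hC0 : 0 < C := (hp0 0).trans_le (hC 0)
  have hq : Continuous fun t => (p t)⁻¹ := hp.inv₀ fun t => (hp0 t).ne'
  set F : ℝ → ℝ := fun t => ∫ s in (0 : ℝ)..t, (p s)⁻¹ with hF
  have hFd : ∀ t, HasDerivAt F (p t)⁻¹ t := fun t =>
    (hq.integral_hasStrictDerivAt 0 t).hasDerivAt
  have hFmono : StrictMono F := strictMono_of_deriv_pos fun t => by
    rw [(hFd t).deriv]; exact inv_pos.2 (hp0 t)
  -- The bound `p ≤ C` gives `F` a slope of at least `1 / C`. Hence `F` is onto, and its inverse is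
  -- the required change of time.
  have hGmono : Monotone fun t => F t - C⁻¹ * t := by
    have hGd : ∀ t, HasDerivAt (fun t => F t - C⁻¹ * t) ((p t)⁻¹ - C⁻¹ * 1) t := fun t =>
      (hFd t).sub ((hasDerivAt_id t).const_mul _)
    refine monotone_of_deriv_nonneg (fun t => (hGd t).differentiableAt) fun t => ?_
    rw [(hGd t).deriv, mul_one, sub_nonneg]
    exact inv_anti₀ (hp0 t) (hC t)
  have hF0 : F 0 = 0 := by simp [hF]
  have hFtop : Tendsto F atTop atTop := by
    refine tendsto_atTop_mono' atTop ?_ (tendsto_id.const_mul_atTop (inv_pos.2 hC0))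
    filter_upwards [eventually_ge_atTop 0] with t ht
    have := hGmono ht
    simp only [hF0, mul_zero, sub_zero] at this
    simpa using this
  have hFbot : Tendsto F atBot atBot := by
    refine tendsto_atBot_mono' atBot ?_ (tendsto_id.const_mul_atBot (inv_pos.2 hC0))
    filter_upwards [eventually_le_atBot 0] with t ht
    have := hGmono ht
    simp only [hF0, mul_zero, sub_zero] at this
    simpa using this
  have hFc : Continuous F := continuous_iff_continuousAt.2 fun t => (hFd t).continuousAt
  let E : ℝ ≃o ℝ := hFmono.orderIsoOfSurjective F (hFc.surjective hFtop hFbot)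
  have hE : ∀ t, E t = F t := fun t => rfl
  refine ⟨E.symm, fun x => ?_, E.symm.tendsto_atTop, E.symm.tendsto_atBot⟩
  have := HasDerivAt.of_local_left_inverse (f := F) (g := E.symm) (a := x)
    E.symm.continuous.continuousAt (hFd _) (inv_ne_zero (hp0 _).ne')
    (Eventually.of_forall fun y => by rw [← hE]; exact E.apply_symm_apply y)
  rwa [inv_inv] at this

/-! ### The profile equation in the plane of the frame. -/

/-- The dissipation of a motion within the plane of a frame adapted to the front. -/
theorem IsFrame.diss_planar {e n : Vec} (h : IsFrame e n) (η μ ν : ℝ) {ξ : Vec} {X : ℝ}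
    (hξ : lower ξ = X • n) {ρ v : ℝ} (hρ : 0 < ρ) (hv : v ^ 2 < 1) (r w : ℝ) {β : ℝ}
    (hβ : β = v * w - r * (1 - v ^ 2)) :
    diss η μ ν ξ (planar e n ρ v) ((ρ * r) • (e + v • n) + (ρ * w) • n) =
      (X ^ 2 * ρ / (1 - v ^ 2) ^ 2) •
        ((4 / 3 * η * w * v - 4 * μ * v * (3 * v * β + w) - ν * (β + v * w) * (1 + v ^ 2)) • e +
        (4 / 3 * η * w - μ * (3 * v * β + w) * (1 + 3 * v ^ 2) - 2 * ν * v * (β + v * w)) • n) := by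
  have h1 := h.temp_planar_sq hρ hv
  have hmem := (h.planar_mem hρ hv).1
  set θ := temp (planar e n ρ v) with hθ
  set s := 1 - v ^ 2 with hs
  have hs0 : 0 < s := by rw [hs]; linarith
  have hu : vel (planar e n ρ v) = (θ * ρ) • e + (θ * ρ * v) • n := by
    rw [vel_eq_smul, ← hθ, planar_eq, smul_add, smul_smul, smul_smul, mul_assoc]
  have hW : (ρ * r) • (e + v • n) + (ρ * w) • n = (ρ * r) • e + (ρ * r * v + ρ * w) • n := by
    rw [smul_add, smul_smul, add_smul, add_assoc]
  have hN : lower ξ = (0 : ℝ) • e + X • n := by rw [hξ, zero_smul, zero_add]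
  -- The Lorentz factor of the speed `v`.
  set c := θ * ρ with hc
  have hcs : c ^ 2 = 1 / s := by
    rw [eq_div_iff hs0.ne', hc]; linarith
  have hvs : v ^ 2 = 1 - s := by rw [hs]; ring
  have hτ : c * v * X = mink (vel (planar e n ρ v)) (lower ξ) := by
    rw [hu, hN, h.mink_comb]; ring
  have hb : c * ρ * β = mink (vel (planar e n ρ v)) ((ρ * r) • (e + v • n) + (ρ * w) • n) := by
    rw [hu, hW, h.mink_comb, hβ, hs]; ring
  have hP : X * c ^ 2 * ρ * w = mink (lower ξ) ((ρ * r) • (e + v • n) + (ρ * w) • n) +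
      c * v * X * (c * ρ * β) := by
    rw [hW, hN, h.mink_comb, hβ]
    have : c ^ 2 * s = 1 := by rw [hcs]; field_simp
    rw [hs] at this ⊢
    linear_combination (X * ρ * w + X * ρ * v * r) * this
  have hK : X ^ 2 * c ^ 2 = mink (lower ξ) (lower ξ) + (c * v * X) ^ 2 := by
    rw [hN, h.mink_comb]
    have : c ^ 2 * s = 1 := by rw [hcs]; field_simp
    rw [hs] at this
    linear_combination X ^ 2 * this
  have hc4 : c ^ 2 * s = 1 := by rw [hcs]; field_simp
  have hPN : (X * c ^ 2) • (v • e + n) =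
      lower ξ + (c * v * X) • vel (planar e n ρ v) := by
    rw [hN, hu]
    funext α
    simp only [Pi.add_apply, Pi.smul_apply, smul_eq_mul]
    rw [hs] at hc4
    linear_combination (X * n α) * hc4
  have hPW : (ρ * w * c ^ 2) • (v • e + n) = (ρ * r) • (e + v • n) + (ρ * w) • n +
      (c * ρ * β) • vel (planar e n ρ v) := by
    rw [hu, hβ]
    funext α
    simp only [Pi.add_apply, Pi.smul_apply, smul_eq_mul]
    rw [hs] at hc4 ⊢
    linear_combination (ρ * w * n α + ρ * r * (e α + v * n α)) * hc4
  have hk : X ^ 2 * ρ / s ^ 2 = X ^ 2 * ρ * c ^ 4 := by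
    rw [show c ^ 4 = (c ^ 2) ^ 2 by ring, hcs]; field_simp
  rw [diss_eq η μ ν ξ _ hmem rfl hτ hb hP hK hPN hPW, hu, hk]
  funext α
  simp only [Pi.sub_apply, Pi.add_apply, Pi.smul_apply, smul_eq_mul]
  ring

/-- The scalar form of the profile equation. -/
theorem scalar_system {η μ ν v κ G p Φ s σ : ℝ} (hv : v ≠ 0) (hs : s = 1 - v ^ 2)
    (hσ : σ = 1 - 3 * v ^ 2) {β : ℝ} (hβ : 4 * β = s * (Φ * p) - p * (1 + v ^ 2) / v)
    (h1 : -(9 * μ * v ^ 2 + ν) * s * (Φ * p) + σ * (ν - 3 * μ * v ^ 2) / v * p =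
      3 * G * (κ * s - 1))
    (h2 : -(3 * μ + ν) * v * s * (Φ * p) + (16 / 3 * η + (ν - μ) * σ) * p = G * (κ * s + 3) / v) :
    4 / 3 * η * p * v - 4 * μ * v * (3 * v * β + p) - ν * (β + v * p) * (1 + v ^ 2) =
      G * s * κ ∧
    4 / 3 * η * p - μ * (3 * v * β + p) * (1 + 3 * v ^ 2) - 2 * ν * v * (β + v * p) =
      G * s * (3 + κ * (1 + 3 * v ^ 2)) / (4 * v) := by
  have hβ' : β = (s * (Φ * p) - p * (1 + v ^ 2) / v) / 4 := by linarith
  constructor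
  · have : G * s * κ = (3 * G * (κ * s - 1) + v * (G * (κ * s + 3) / v)) / 4 := by
      field_simp; ring
    rw [this, ← h1, ← h2, hβ', hσ, hs]
    field_simp
    ring
  · have : G * s * (3 + κ * (1 + 3 * v ^ 2)) / (4 * v) =
        (v * (3 * G * (κ * s - 1)) + G * (κ * s + 3) / v) / 4 := by
      rw [hs]; field_simp; ring
    rw [this, ← h1, ← h2, hβ', hσ, hs]
    field_simp
    ring

/-! ### Coefficients of the slow-fast system. -/

/-- The coefficients of the fast equation, as functions of the velocity. -/
def coefA (η μ ν v : ℝ) : ℝ :=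
  -(v * (1 - v ^ 2) * (3 * (16 / 3 * η + (ν - μ) * (1 - 3 * v ^ 2)) -
    (1 - 3 * v ^ 2) * (ν - 3 * μ * v ^ 2) / v ^ 2))

def coefB (η μ ν v : ℝ) : ℝ :=
  v * (3 * (16 / 3 * η + (ν - μ) * (1 - 3 * v ^ 2)) +
    3 * (1 - 3 * v ^ 2) * (ν - 3 * μ * v ^ 2) / v ^ 2)

/-- This coefficient of `κ` in `denom` vanishes at the sonic point, where `ratio` thus becomes
affine in `κ`. -/
def coefG (ν v : ℝ) : ℝ := (1 - v ^ 2) * ν * (1 - 3 * v ^ 2)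

def coefH (μ ν v : ℝ) : ℝ := 36 * μ * v ^ 2 + 3 * ν * (1 + v ^ 2)

def denom (μ ν v κ : ℝ) : ℝ := (1 - v ^ 2) * (coefG ν v * κ + coefH μ ν v)

/-- The ratio of the rates of `log E` and of the velocity. -/
def ratio (η μ ν v κ : ℝ) : ℝ := (coefA η μ ν v * κ + coefB η μ ν v) / denom μ ν v κ

/-- The coefficient of the rate of the velocity. -/
def slowCoef (η μ ν v κ : ℝ) : ℝ :=
  16 / 3 * η + (ν - μ) * (1 - 3 * v ^ 2) - (3 * μ + ν) * v * (1 - v ^ 2) * ratio η μ ν v κ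

/-- The energy flux in units of its value at the rest points. The factor `(a - v) * (v - b)`
vanishes at both ends, so that every bounded `κ` yields the right limits. -/
def relEnergy (a b v κ : ℝ) : ℝ := 1 - κ * ((a - v) * (v - b))

/-- The rate of the fast variable. -/
def fastRate (η μ ν a b v κ : ℝ) : ℝ :=
  relEnergy a b v κ * ratio η μ ν v κ + κ * (a + b - 2 * v)

/-- The two components of the profile equation are proportional to the same rate `p` of the
velocity. Elimination of `p` leaves a linear equation for the ratio of the rates, and `ratio` is its
solution. -/
theorem ratio_system {η μ ν v κ : ℝ} (hv : v ≠ 0) (hd : denom μ ν v κ ≠ 0) :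
    (κ * (1 - v ^ 2) + 3) / v * (-(9 * μ * v ^ 2 + ν) * (1 - v ^ 2) * ratio η μ ν v κ +
      (1 - 3 * v ^ 2) * (ν - 3 * μ * v ^ 2) / v) =
    3 * (κ * (1 - v ^ 2) - 1) * slowCoef η μ ν v κ := by
  have h : ratio η μ ν v κ * denom μ ν v κ = coefA η μ ν v * κ + coefB η μ ν v :=
    div_mul_cancel₀ _ hd
  rw [slowCoef]
  generalize ratio η μ ν v κ = r at h
  simp only [denom, coefA, coefB, coefG, coefH] at h
  field_simp at h ⊢
  linear_combination (-1 : ℝ) * h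

/-- The difference quotient of the rational function `ratio`. -/
def ratioSlope (η μ ν v κ κ' : ℝ) : ℝ :=
  (1 - v ^ 2) * (coefA η μ ν v * coefH μ ν v - coefB η μ ν v * coefG ν v) /
    (denom μ ν v κ * denom μ ν v κ')

theorem ratio_sub {η μ ν v κ κ' : ℝ} (hd : denom μ ν v κ ≠ 0) (hd' : denom μ ν v κ' ≠ 0) :
    ratio η μ ν v κ - ratio η μ ν v κ' = (κ - κ') * ratioSlope η μ ν v κ κ' := by
  rw [ratio, ratio, ratioSlope, div_sub_div _ _ hd hd']
  rw [mul_div_assoc']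
  congr 1
  simp only [denom]
  ring

/-- A difference quotient in closed form, continuous also where `κ = κ'`. A Lipschitz constant of
`fastRate` thus follows from continuity at the sonic point. -/
def fastSlope (η μ ν a b v κ κ' : ℝ) : ℝ :=
  relEnergy a b v κ * ratioSlope η μ ν v κ κ' - (a - v) * (v - b) * ratio η μ ν v κ' +
    (a + b - 2 * v)

theorem fastRate_sub {η μ ν a b v κ κ' : ℝ} (hd : denom μ ν v κ ≠ 0)
    (hd' : denom μ ν v κ' ≠ 0) :
    fastRate η μ ν a b v κ - fastRate η μ ν a b v κ' =
      (κ - κ') * fastSlope η μ ν a b v κ κ' := by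
  have h := ratio_sub (η := η) hd hd'
  simp only [fastRate, fastSlope, relEnergy] at *
  linear_combination (1 - κ * ((a - v) * (v - b))) * h

section continuity
variable {X : Type*} [TopologicalSpace X] {x : X} {fa fb fv fk fk' : X → ℝ}

theorem continuousAt_denom (μ ν : ℝ) (hv : ContinuousAt fv x) (hk : ContinuousAt fk x) :
    ContinuousAt (fun y => denom μ ν (fv y) (fk y)) x := by
  unfold denom coefG coefH; fun_prop

theorem continuousAt_ratio (η μ ν : ℝ) (hv : ContinuousAt fv x) (hk : ContinuousAt fk x)
    (hv0 : fv x ≠ 0) (hd : denom μ ν (fv x) (fk x) ≠ 0) :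
    ContinuousAt (fun y => ratio η μ ν (fv y) (fk y)) x := by
  have hv2 : fv x ^ 2 ≠ 0 := pow_ne_zero 2 hv0
  refine ContinuousAt.div₀ ?_ (continuousAt_denom μ ν hv hk) hd
  unfold coefA coefB
  fun_prop (disch := assumption)

theorem continuousAt_slowCoef (η μ ν : ℝ) (hv : ContinuousAt fv x) (hk : ContinuousAt fk x)
    (hv0 : fv x ≠ 0) (hd : denom μ ν (fv x) (fk x) ≠ 0) :
    ContinuousAt (fun y => slowCoef η μ ν (fv y) (fk y)) x := by
  have := continuousAt_ratio η μ ν hv hk hv0 hd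
  unfold slowCoef
  fun_prop

theorem continuousAt_relEnergy (ha : ContinuousAt fa x) (hb : ContinuousAt fb x)
    (hv : ContinuousAt fv x) (hk : ContinuousAt fk x) :
    ContinuousAt (fun y => relEnergy (fa y) (fb y) (fv y) (fk y)) x := by
  unfold relEnergy; fun_prop

theorem continuousAt_fastRate (η μ ν : ℝ) (ha : ContinuousAt fa x) (hb : ContinuousAt fb x)
    (hv : ContinuousAt fv x) (hk : ContinuousAt fk x)
    (hv0 : fv x ≠ 0) (hd : denom μ ν (fv x) (fk x) ≠ 0) :
    ContinuousAt (fun y => fastRate η μ ν (fa y) (fb y) (fv y) (fk y)) x := by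
  have h1 := continuousAt_ratio η μ ν hv hk hv0 hd
  have h2 := continuousAt_relEnergy ha hb hv hk
  unfold fastRate
  fun_prop

theorem continuousAt_fastSlope (η μ ν : ℝ) (ha : ContinuousAt fa x) (hb : ContinuousAt fb x)
    (hv : ContinuousAt fv x) (hk : ContinuousAt fk x) (hk' : ContinuousAt fk' x)
    (hv0 : fv x ≠ 0) (hd : denom μ ν (fv x) (fk x) ≠ 0) (hd' : denom μ ν (fv x) (fk' x) ≠ 0) :
    ContinuousAt (fun y => fastSlope η μ ν (fa y) (fb y) (fv y) (fk y) (fk' y)) x := by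
  have h1 := continuousAt_ratio η μ ν hv hk' hv0 hd'
  have h2 := continuousAt_relEnergy ha hb hv hk
  have h3 := continuousAt_denom μ ν hv hk
  have h4 := continuousAt_denom μ ν hv hk'
  have hv2 : fv x ^ 2 ≠ 0 := pow_ne_zero 2 hv0
  have h5 : ContinuousAt (fun y => ratioSlope η μ ν (fv y) (fk y) (fk' y)) x := by
    refine ContinuousAt.div₀ ?_ (h3.mul h4) (mul_ne_zero hd hd')
    unfold coefA coefB coefG coefH
    fun_prop (disch := assumption)
  unfold fastSlope
  fun_prop

end continuity

/-! ### The sonic point and its neighbourhood. -/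

/-- The contraction rate at the sonic point `v`. -/
def sonicRate (η μ ν v : ℝ) : ℝ := 4 * η * v / (3 * μ + ν)

section sonic
variable {η μ ν v : ℝ}

theorem denom_sonic (hv : v ^ 2 = 1 / 3) (κ : ℝ) : denom μ ν v κ = 8 / 3 * (3 * μ + ν) := by
  simp only [denom, coefG, coefH, hv]; ring

/-- Here the origin of the strip `0 ≤ κ ≤ 3` is visible: the equation relaxes to `κ = 3 / 2`, its
midpoint. -/
theorem ratio_sonic (hv : v ^ 2 = 1 / 3) (hm : 3 * μ + ν ≠ 0) (κ : ℝ) :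
    ratio η μ ν v κ = -(sonicRate η μ ν v * (κ - 3 / 2)) := by
  rw [ratio, denom_sonic hv, sonicRate]
  simp only [coefA, coefB, hv]
  field_simp
  ring

theorem ratioSlope_sonic (hv : v ^ 2 = 1 / 3) (hm : 3 * μ + ν ≠ 0) (κ κ' : ℝ) :
    ratioSlope η μ ν v κ κ' = -sonicRate η μ ν v := by
  rw [ratioSlope, denom_sonic hv, denom_sonic hv, sonicRate]
  simp only [coefA, coefB, coefG, coefH, hv]
  field_simp
  ring

theorem slowCoef_sonic (hv : v ^ 2 = 1 / 3) (hm : 3 * μ + ν ≠ 0) (κ : ℝ) :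
    slowCoef η μ ν v κ = 8 / 9 * η * κ + 4 * η := by
  rw [slowCoef, ratio_sonic hv hm, sonicRate, hv]
  field_simp
  rw [hv]
  ring

end sonic

/-- What is needed of the coefficients for the construction of a profile. -/
structure GoodPoint (η μ ν lam a b v κ : ℝ) : Prop where
  denom_pos : 0 < denom μ ν v κ
  slow_pos : 0 < slowCoef η μ ν v κ
  rel_pos : 0 < relEnergy a b v κ
  lower : 0 ≤ fastRate η μ ν a b v κ + lam * κ
  upper : fastRate η μ ν a b v κ + lam * κ ≤ lam * 3

/-- At `a = b = v = v₀` the fast rate is `-lam * (κ - 3 / 2)`. All conditions then hold strictly for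
`κ` in `[0, 3]`, with `3 / 2 * lam` midway between the bounds of `lower` and `upper`. Compactness in
`κ`, `κ'` makes the neighbourhood uniform. -/
theorem eventually_goodPoint {η μ ν v₀ : ℝ} (hη : 0 < η) (hμ : 0 < μ) (hν : 0 < ν)
    (hv : v₀ ^ 2 = 1 / 3) (hv0 : 0 < v₀) :
    ∀ᶠ x : ℝ × ℝ × ℝ in 𝓝 (v₀, v₀, v₀), ∀ k ∈ Set.Icc (0 : ℝ) 3 ×ˢ Set.Icc (0 : ℝ) 3,
      GoodPoint η μ ν (sonicRate η μ ν v₀) x.1 x.2.1 x.2.2 k.1 ∧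
      |fastSlope η μ ν x.1 x.2.1 x.2.2 k.1 k.2 + sonicRate η μ ν v₀| < sonicRate η μ ν v₀ / 2 := by
  have hm : 0 < 3 * μ + ν := by positivity
  have hl : 0 < sonicRate η μ ν v₀ := by unfold sonicRate; positivity
  set lam := sonicRate η μ ν v₀ with hlam
  refine (isCompact_Icc.prod isCompact_Icc).eventually_forall_of_forall_eventually
    (P := fun (x : ℝ × ℝ × ℝ) (k : ℝ × ℝ) => GoodPoint η μ ν lam x.1 x.2.1 x.2.2 k.1 ∧
      |fastSlope η μ ν x.1 x.2.1 x.2.2 k.1 k.2 + lam| < lam / 2) ?_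
  rintro ⟨κ, κ'⟩ ⟨⟨hκ0, hκ3⟩, -⟩
  simp only at hκ0 hκ3
  have hd : ∀ κ, denom μ ν v₀ κ ≠ 0 := fun κ => by rw [denom_sonic hv]; positivity
  set z : (ℝ × ℝ × ℝ) × ℝ × ℝ := ((v₀, v₀, v₀), (κ, κ'))
  have ca : ContinuousAt (fun y : (ℝ × ℝ × ℝ) × ℝ × ℝ => y.1.1) z := by fun_prop
  have cb : ContinuousAt (fun y : (ℝ × ℝ × ℝ) × ℝ × ℝ => y.1.2.1) z := by fun_prop
  have cv : ContinuousAt (fun y : (ℝ × ℝ × ℝ) × ℝ × ℝ => y.1.2.2) z := by fun_prop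
  have ck : ContinuousAt (fun y : (ℝ × ℝ × ℝ) × ℝ × ℝ => y.2.1) z := by fun_prop
  have ck' : ContinuousAt (fun y : (ℝ × ℝ × ℝ) × ℝ × ℝ => y.2.2) z := by fun_prop
  have e1 := (continuousAt_denom μ ν cv ck).eventually (lt_mem_nhds (a := 0) (by
    change 0 < denom μ ν v₀ κ
    rw [denom_sonic hv]; positivity))
  have e2 := (continuousAt_slowCoef η μ ν cv ck hv0.ne' (hd κ)).eventually
    (lt_mem_nhds (a := 0) (by
      change 0 < slowCoef η μ ν v₀ κ
      rw [slowCoef_sonic hv hm.ne']; positivity))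
  have e3 := (continuousAt_relEnergy ca cb cv ck).eventually (lt_mem_nhds (a := 0) (by
    change 0 < relEnergy v₀ v₀ v₀ κ
    simp [relEnergy]))
  have hrate : fastRate η μ ν v₀ v₀ v₀ κ + lam * κ = 3 / 2 * lam := by
    rw [fastRate, ratio_sonic hv hm.ne', relEnergy, ← hlam]; ring
  have c4 := (continuousAt_fastRate η μ ν ca cb cv ck hv0.ne' (hd κ)).add (ck.const_mul lam)
  have e4 := c4.eventually (lt_mem_nhds (a := 0) (by
    change 0 < fastRate η μ ν v₀ v₀ v₀ κ + lam * κ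
    rw [hrate]; positivity))
  have e5 := c4.eventually (gt_mem_nhds (a := lam * 3) (by
    change fastRate η μ ν v₀ v₀ v₀ κ + lam * κ < lam * 3
    rw [hrate]; linarith))
  have hslope : fastSlope η μ ν v₀ v₀ v₀ κ κ' + lam = 0 := by
    rw [fastSlope, ratioSlope_sonic hv hm.ne', relEnergy, ← hlam]; ring
  have e6 := ((continuousAt_fastSlope η μ ν ca cb cv ck ck' hv0.ne' (hd κ) (hd κ')).add
    (continuousAt_const (y := lam))).abs.eventually (gt_mem_nhds (a := lam / 2) (by
      change |fastSlope η μ ν v₀ v₀ v₀ κ κ' + lam| < lam / 2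
      rw [hslope]; simpa using hl))
  filter_upwards [e1, e2, e3, e4, e5, e6] with y h1 h2 h3 h4 h5 h6
  exact ⟨⟨h1, h2, h3, h4.le, h5.le⟩, h6⟩

/-! ### Return from the slow-fast system to the profile equation. -/

/-- The rate at which the curve `κ(t)` has to be traversed. -/
def traverseRate (η μ ν X Q ρ v κ : ℝ) : ℝ :=
  4 * Q * (1 - v ^ 2) / (3 * X * ρ) * (κ * (1 - v ^ 2) + 3) / v / slowCoef η μ ν v κ

theorem IsFrame.planar_ode {e n : Vec} (h : IsFrame e n) {η μ ν : ℝ} {ξ : Vec} {X : ℝ}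
    (hX : 0 < X) (hξ : lower ξ = X • n) {ρ v κ a b Q p D Φ : ℝ} (hρ : 0 < ρ) (hv0 : 0 < v)
    (hv : v ^ 2 < 1) (hab : a * b = 1 / 3) (hd : denom μ ν v κ ≠ 0)
    (hS : slowCoef η μ ν v κ ≠ 0) (hQ : energy ρ v * v = Q * relEnergy a b v κ)
    (hp : p = traverseRate η μ ν X Q ρ v κ) (hD : D = (a - v) * (v - b))
    (hΦ : Φ = ratio η μ ν v κ) :
    diss η μ ν ξ (planar e n ρ v)
      ((ρ * (p * ((-D / v - -D * Φ + 6 * v * -D / (1 - v ^ 2)) / 4))) • (e + v • n) +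
        (ρ * (p * -D)) • n) =
      flux ξ (planar e n ρ v) - X • ((4 / 3 * Q) • e + (Q * (a + b)) • n) := by
  have hs0 : 0 < 1 - v ^ 2 := by linarith
  set s := 1 - v ^ 2 with hs
  set σ := 1 - 3 * v ^ 2 with hσ
  set G := 4 * Q * s / (3 * X * ρ) with hG
  set β := (s * (Φ * p) - p * (1 + v ^ 2) / v) / 4 with hβ
  -- `traverseRate` is defined so that this holds. It is the component `h2` of the equation along
  -- the projected normal, in the rest frame of the fluid.
  have hpS : p * slowCoef η μ ν v κ = G * (κ * s + 3) / v := by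
    rw [hp, traverseRate, ← hs, ← hG]; field_simp
  have h2 : -(3 * μ + ν) * v * s * (Φ * p) + (16 / 3 * η + (ν - μ) * σ) * p =
      G * (κ * s + 3) / v := by
    rw [← hpS, slowCoef, ← hs, ← hσ, ← hΦ]; ring
  -- The component along the velocity; it is compatible with `h2` by the choice of `ratio`.
  have h1 : -(9 * μ * v ^ 2 + ν) * s * (Φ * p) + σ * (ν - 3 * μ * v ^ 2) / v * p =
      3 * G * (κ * s - 1) := by
    have hr := ratio_system (η := η) hv0.ne' hd
    rw [← hs, ← hσ, ← hΦ] at hr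
    refine mul_right_cancel₀ hS ?_
    linear_combination (-(9 * μ * v ^ 2 + ν) * s * Φ + σ * (ν - 3 * μ * v ^ 2) / v) * hpS + G * hr
  obtain ⟨k1, k2⟩ := scalar_system hv0.ne' hs hσ (by rw [hβ]; ring : 4 * β = _) h1 h2
  have hβ' : -D * β = v * (p * -D) -
      (p * ((-D / v - -D * Φ + 6 * v * -D / s) / 4)) * (1 - v ^ 2) := by
    rw [← hs, hβ]
    field_simp
    rw [hs]
    ring
  rw [h.diss_planar η μ ν hξ hρ hv _ _ hβ', h.flux_planar hξ hρ hv, ← hs]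
  have hen : energy ρ v = Q * relEnergy a b v κ / v := by rw [← hQ]; field_simp
  rw [hQ, hen, relEnergy, ← hD]
  have c1 : X ^ 2 * ρ / s ^ 2 * (4 / 3 * η * (p * -D) * v -
      4 * μ * v * (3 * v * (-D * β) + p * -D) - ν * (-D * β + v * (p * -D)) * (1 + v ^ 2)) =
      X * (4 / 3 * (Q * (1 - κ * D)) - 4 / 3 * Q) := by
    calc _ = X ^ 2 * ρ / s ^ 2 * -D * (4 / 3 * η * p * v - 4 * μ * v * (3 * v * β + p) -
          ν * (β + v * p) * (1 + v ^ 2)) := by ring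
      _ = _ := by rw [k1, hG]; field_simp; ring
  have c2 : X ^ 2 * ρ / s ^ 2 * (4 / 3 * η * (p * -D) -
      μ * (3 * v * (-D * β) + p * -D) * (1 + 3 * v ^ 2) - 2 * ν * v * (-D * β + v * (p * -D))) =
      X * (1 / 3 * (Q * (1 - κ * D) / v * (1 + 3 * v ^ 2)) - Q * (a + b)) := by
    calc _ = X ^ 2 * ρ / s ^ 2 * -D * (4 / 3 * η * p - μ * (3 * v * β + p) * (1 + 3 * v ^ 2) -
          2 * ν * v * (β + v * p)) := by ring
      _ = _ := by
        have hDv : 1 + 3 * v ^ 2 - 3 * v * (a + b) = -3 * D := by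
          rw [hD]; linear_combination (-3 : ℝ) * hab
        rw [k2, hG]
        field_simp
        linear_combination (-Q) * hDv
  funext α
  simp only [Pi.sub_apply, Pi.add_apply, Pi.smul_apply, smul_eq_mul]
  linear_combination e α * c1 + n α * c2

/-! ### Density, logistic transition and amplitude. -/

/-- The size `ρ` of the planar state with prescribed energy flux. -/
def density (Q v E : ℝ) : ℝ :=
  Real.exp ((Real.log v - Real.log Q - Real.log E - 3 * Real.log (1 - v ^ 2)) / 4)

theorem density_pos (Q v E : ℝ) : 0 < density Q v E := Real.exp_pos _

/-- The density is the fourth root of `v / (Q * E * (1 - v ^ 2) ^ 3)`. Its form as an exponential of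
logarithms gives positivity and the logarithmic derivative at once. -/
theorem energy_density {Q v E : ℝ} (hQ : 0 < Q) (hv0 : 0 < v) (hv : v ^ 2 < 1) (hE : 0 < E) :
    energy (density Q v E) v * v = Q * E := by
  have hs : 0 < 1 - v ^ 2 := by linarith
  have : density Q v E ^ 4 = v / (Q * E * (1 - v ^ 2) ^ 3) := by
    rw [density, ← Real.exp_nat_mul, ← Real.exp_log (by positivity :
      0 < v / (Q * E * (1 - v ^ 2) ^ 3)), Real.log_div hv0.ne' (by positivity),
      Real.log_mul (by positivity) (by positivity), Real.log_mul hQ.ne' hE.ne', Real.log_pow]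
    congr 1
    push_cast
    ring
  rw [energy, this]
  field_simp

theorem density_unique {Q v ρ : ℝ} (hQ : 0 < Q) (hv0 : 0 < v) (hv : v ^ 2 < 1) (hρ : 0 < ρ)
    (h : energy ρ v * v = Q) : density Q v 1 = ρ := by
  have h1 := energy_density hQ hv0 hv one_pos
  have hs : 0 < 1 - v ^ 2 := by linarith
  have h2 := mul_right_cancel₀ hv0.ne' (h1.trans ((mul_one Q).trans h.symm))
  rw [energy, energy, inv_inj] at h2
  have h3 := mul_right_cancel₀ (by positivity) h2
  exact (pow_left_inj₀ (density_pos Q v 1).le hρ.le (by norm_num)).1 h3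

theorem hasDerivAt_density {Q : ℝ} {v E : ℝ → ℝ} {v' E' t : ℝ} (hv : HasDerivAt v v' t)
    (hE : HasDerivAt E E' t) (hv0 : 0 < v t) (hv1 : v t ^ 2 < 1) (hE0 : 0 < E t) :
    HasDerivAt (fun t => density Q (v t) (E t)) (density Q (v t) (E t) *
      ((v' / v t - E' / E t + 6 * v t * v' / (1 - v t ^ 2)) / 4)) t := by
  have hs : 1 - v t ^ 2 ≠ 0 := by linarith
  have h1 : HasDerivAt (fun t => 1 - v t ^ 2) (-(2 * v t * v')) t :=
    ((hv.pow 2).const_sub 1).congr_deriv (by ring)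
  have := (((((hv.log hv0.ne').sub_const (Real.log Q)).sub (hE.log hE0.ne')).sub
    ((h1.log hs).const_mul 3)).div_const 4).exp
  refine this.congr_deriv ?_
  unfold density
  congr 1
  field_simp
  ring

theorem continuousAt_density {X : Type*} [TopologicalSpace X] {x : X} (Q : ℝ) {v E : X → ℝ}
    (hv : ContinuousAt v x) (hE : ContinuousAt E x) (hv0 : 0 < v x) (hv1 : v x ^ 2 < 1)
    (hE0 : 0 < E x) : ContinuousAt (fun y => density Q (v y) (E y)) x := by
  have hs : 1 - v x ^ 2 ≠ 0 := by linarith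
  have h0 := hv0.ne'
  have h1 := hE0.ne'
  have c1 : ContinuousAt (fun y => Real.log (v y)) x := hv.log h0
  have c2 : ContinuousAt (fun y => Real.log (E y)) x := hE.log h1
  have c3 : ContinuousAt (fun y => Real.log (1 - v y ^ 2)) x :=
    ContinuousAt.log (by fun_prop) hs
  unfold density
  exact ((((c1.sub continuousAt_const).sub c2).sub (continuousAt_const.mul c3)).div_const 4).rexp

/-- The decreasing logistic transition from `a` to `b`. -/
def logistic (a b t : ℝ) : ℝ := b + (a - b) / (1 + Real.exp ((a - b) * t))

theorem logistic_mem {a b : ℝ} (h : b < a) (t : ℝ) : b < logistic a b t ∧ logistic a b t < a := by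
  have he := Real.exp_pos ((a - b) * t)
  have hab : 0 < a - b := by linarith
  unfold logistic
  constructor
  · have : 0 < (a - b) / (1 + Real.exp ((a - b) * t)) := by positivity
    linarith
  · have : (a - b) / (1 + Real.exp ((a - b) * t)) < a - b := by
      rw [div_lt_iff₀ (by positivity)]; nlinarith
    linarith

theorem hasDerivAt_logistic (a b t : ℝ) :
    HasDerivAt (logistic a b) (-((a - logistic a b t) * (logistic a b t - b))) t := by
  have he := Real.exp_pos ((a - b) * t)
  have h1 : HasDerivAt (fun t => 1 + Real.exp ((a - b) * t))
      (Real.exp ((a - b) * t) * ((a - b) * 1)) t :=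
    (((hasDerivAt_id t).const_mul (a - b)).exp).const_add 1
  have h2 := ((h1.inv (by positivity)).const_mul (a - b)).const_add b
  refine (h2.congr_of_eventuallyEq (Eventually.of_forall fun y => ?_)).congr_deriv ?_
  · simp [logistic, div_eq_mul_inv]
  · simp only [logistic]
    field_simp
    ring

theorem tendsto_logistic_atTop {a b : ℝ} (h : b < a) : Tendsto (logistic a b) atTop (𝓝 b) := by
  have h1 : Tendsto (fun t => 1 + Real.exp ((a - b) * t)) atTop atTop :=
    tendsto_atTop_add_const_left _ _
      (Real.tendsto_exp_atTop.comp (tendsto_id.const_mul_atTop (by linarith)))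
  unfold logistic
  simpa using (h1.const_div_atTop (a - b)).const_add b

theorem tendsto_logistic_atBot {a b : ℝ} (h : b < a) : Tendsto (logistic a b) atBot (𝓝 a) := by
  have h1 : Tendsto (fun t => 1 + Real.exp ((a - b) * t)) atBot (𝓝 (1 + 0)) :=
    (Real.tendsto_exp_atBot.comp (tendsto_id.const_mul_atBot (by linarith))).const_add 1
  have := ((tendsto_const_nhds (x := a - b)).div h1 (by norm_num)).const_add b
  unfold logistic
  simpa using this

/-- With `r = θ² ρ ρ'`, the components of the scaled jump in the rest frame of the first state are
`r * (1 - v * v') - 1 = 2 / 3 * r - 1` and `r * (v' - v)`. The first one keeps `r` above `3 / 4`,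
and then the second one controls `v' - v`. Which of the two states is supersonic plays no role. -/
theorem IsFrame.abs_sub_lt_of_amplitude {e n : Vec} (h : IsFrame e n) {ρ ρ' v v' ε : ℝ}
    (hρ : 0 < ρ) (hv : v ^ 2 < 1) (hvv : v * v' = 1 / 3) (hε : ε ≤ 1 / 2)
    (ha : amplitude (planar e n ρ v) (planar e n ρ' v') < ε) : |v' - v| < 2 * ε := by
  have h1 := h.temp_planar_sq hρ hv
  have hθ := temp_pos (h.planar_mem hρ hv).1
  rw [amplitude] at ha
  have hsub : planar e n ρ' v' - planar e n ρ v = (ρ' - ρ) • e + (ρ' * v' - ρ * v) • n := by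
    rw [planar_eq, planar_eq, sub_smul, sub_smul]; abel
  have hu : mink (vel (planar e n ρ v)) (planar e n ρ' v' - planar e n ρ v) =
      temp (planar e n ρ v) * (ρ * v * (ρ' * v' - ρ * v) - ρ * (ρ' - ρ)) := by
    rw [vel_eq_smul, mink_smul_left, hsub, planar_eq, h.mink_comb]
  rw [hu, hsub, h.mink_comb] at ha
  set θ := temp (planar e n ρ v) with hθdef
  have hε0 : 0 < ε := lt_of_le_of_lt (by positivity) ha
  rw [mul_comm, ← lt_div_iff₀ hθ] at ha
  have hA := Real.lt_sq_of_sqrt_lt ha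
  rw [div_pow, lt_div_iff₀ (by positivity)] at hA
  set r := θ ^ 2 * ρ * ρ' with hr
  have key : (2 / 3 * r - 1) ^ 2 + (r * (v' - v)) ^ 2 < ε ^ 2 := by
    have hv2 : (2 / 3 : ℝ) = 1 - v * v' := by rw [hvv]; norm_num
    refine lt_of_eq_of_lt ?_ hA
    rw [hv2, hr]
    linear_combination (4 * (θ ^ 2 * ρ * ρ') * (1 - v * v') - θ ^ 2 * ρ' ^ 2 * (1 - v' ^ 2) -
      2 * (θ ^ 2 * (ρ ^ 2 * (1 - v ^ 2))) - 1) * h1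
  have k1 : |2 / 3 * r - 1| < ε :=
    abs_lt_of_sq_lt_sq (by nlinarith [sq_nonneg (r * (v' - v))]) hε0.le
  have k2 : |r * (v' - v)| < ε :=
    abs_lt_of_sq_lt_sq (by nlinarith [sq_nonneg (2 / 3 * r - 1)]) hε0.le
  have hr0 : 3 / 4 < r := by linarith [(abs_lt.1 k1).1]
  rw [abs_mul, abs_of_pos (by linarith)] at k2
  nlinarith [abs_nonneg (v' - v)]

theorem tendsto_density {ι : Type*} {l : Filter ι} (Q : ℝ) {v E : ι → ℝ} {c d : ℝ}
    (hv : Tendsto v l (𝓝 c)) (hE : Tendsto E l (𝓝 d)) (hc0 : 0 < c) (hc1 : c ^ 2 < 1)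
    (hd : 0 < d) : Tendsto (fun t => density Q (v t) (E t)) l (𝓝 (density Q c d)) := by
  have h1 : ContinuousAt (fun z : ℝ × ℝ => density Q z.1 z.2) (c, d) :=
    continuousAt_density Q continuousAt_fst continuousAt_snd hc0 hc1 hd
  exact Tendsto.comp (f := fun t => (v t, E t)) h1 (hv.prodMk_nhds hE)

/-! ### Construction of the profile. -/

/-- A curve that solves the profile equation after a change of time. -/
theorem hasProfile_of_reparam {η μ ν : ℝ} {ξ ψm ψp : Vec} {Ψ Ψ' : ℝ → Vec} {p : ℝ → ℝ}
    (hΨ : ∀ t, HasDerivAt Ψ (Ψ' t) t) (hΨ' : Continuous Ψ') (hp : Continuous p)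
    (hp0 : ∀ t, 0 < p t) {C : ℝ} (hC : ∀ t, p t ≤ C) (hmem : ∀ t, Ψ t ∈ stateSpace)
    (ode : ∀ t, diss η μ ν ξ (Ψ t) (p t • Ψ' t) = flux ξ (Ψ t) - flux ξ ψm)
    (hbot : Tendsto Ψ atBot (𝓝 ψm)) (htop : Tendsto Ψ atTop (𝓝 ψp)) :
    HasProfile η μ ν ξ ψm ψp := by
  obtain ⟨τ, hτ, htτ, hbτ⟩ := exists_time_change hp hp0 hC
  have hd : ∀ x, HasDerivAt (fun x => Ψ (τ x)) (p (τ x) • Ψ' (τ x)) x := fun x =>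
    (hΨ (τ x)).scomp x (hτ x)
  have hτc : Continuous τ := continuous_iff_continuousAt.2 fun x => (hτ x).continuousAt
  refine ⟨fun x => Ψ (τ x), ?_, fun x => hmem _, fun x α => ?_, hbot.comp hbτ, htop.comp htτ⟩
  · rw [contDiff_one_iff_deriv]
    refine ⟨fun x => (hd x).differentiableAt, ?_⟩
    rw [show deriv (fun x => Ψ (τ x)) = fun x => p (τ x) • Ψ' (τ x) from
      funext fun x => (hd x).deriv]
    exact (hp.comp hτc).smul (hΨ'.comp hτc)
  · rw [(hd x).deriv]
    exact congrFun (ode (τ x)) α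

/-- The slow-fast construction of the profile of a weak shock. -/
theorem hasProfile_of_goodPoint {η μ ν : ℝ} {e n ξ : Vec} {X : ℝ} (hf : IsFrame e n) (hX : 0 < X)
    (hN : lower ξ = X • n) {ρa a ρb b : ℝ} (hρa : 0 < ρa) (hρb : 0 < ρb) (hb0 : 0 < b)
    (hba : b < a) (ha1 : a < 1) (hab : a * b = 1 / 3)
    (hE : energy ρa a * a = energy ρb b * b) {lam : ℝ} (hlam : 0 < lam)
    (hgood : ∀ v ∈ Set.Icc b a, ∀ k ∈ Set.Icc (0 : ℝ) 3, GoodPoint η μ ν lam a b v k)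
    (hslope : ∀ v ∈ Set.Icc b a, ∀ k ∈ Set.Icc (0 : ℝ) 3, ∀ k' ∈ Set.Icc (0 : ℝ) 3,
      |fastSlope η μ ν a b v k k' + lam| ≤ lam / 2) :
    HasProfile η μ ν ξ (planar e n ρa a) (planar e n ρb b) := by
  have ha2 : a ^ 2 < 1 := by nlinarith
  have hb2 : b ^ 2 < 1 := by nlinarith
  have hEa := energy_pos hρa ha2
  set Q := energy ρa a * a with hQdef
  have hQ : 0 < Q := mul_pos hEa (hb0.trans hba)
  -- The time is normalised so that the velocity solves `v' = -D` exactly, in spite of the coupling.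
  -- The true rate is restored at the end by `p`.
  set v := logistic a b with hvdef
  have hvm : ∀ t, v t ∈ Set.Icc b a := fun t =>
    ⟨(logistic_mem hba t).1.le, (logistic_mem hba t).2.le⟩
  have hv0 : ∀ w ∈ Set.Icc b a, 0 < w := fun w hw => hb0.trans_le hw.1
  have hv1 : ∀ w ∈ Set.Icc b a, w ^ 2 < 1 := fun w hw => by
    have := hv0 w hw
    have := hw.2
    nlinarith
  have hvd := hasDerivAt_logistic a b
  have hvc : Continuous v := continuous_iff_continuousAt.2 fun t => (hvd t).continuousAt
  -- the fast variable
  obtain ⟨κ, hκm, hκd⟩ := exists_solution_in_strip (m := 3) hlam (by norm_num)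
    (R := fun t y => fastRate η μ ν a b (v t) y + lam * y)
    (fun z hz => by
      have hg := hgood (v z.1) (hvm z.1) z.2 hz.2
      have c1 : ContinuousAt (fun z : ℝ × ℝ => v z.1) z := by fun_prop
      have c2 : ContinuousAt (fun z : ℝ × ℝ => z.2) z := by fun_prop
      exact ((continuousAt_fastRate η μ ν continuousAt_const continuousAt_const c1 c2
        (hv0 _ (hvm z.1)).ne' hg.denom_pos.ne').add (c2.const_mul lam)).continuousWithinAt)
    (fun t y hy => ⟨(hgood _ (hvm t) y hy).lower, (hgood _ (hvm t) y hy).upper⟩)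
    (fun t y hy z hz => by
      have h1 := fastRate_sub (η := η) (a := a) (b := b)
        (hgood _ (hvm t) y hy).denom_pos.ne' (hgood _ (hvm t) z hz).denom_pos.ne'
      have h2 : fastRate η μ ν a b (v t) y + lam * y - (fastRate η μ ν a b (v t) z + lam * z) =
          (fastSlope η μ ν a b (v t) y z + lam) * (y - z) := by linear_combination h1
      rw [h2, abs_mul]
      exact mul_le_mul_of_nonneg_right (hslope _ (hvm t) y hy z hz) (abs_nonneg _))
  replace hκd : ∀ t, HasDerivAt κ (fastRate η μ ν a b (v t) (κ t)) t := fun t =>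
    (hκd t).congr_deriv (by ring)
  have hκc : Continuous κ := continuous_iff_continuousAt.2 fun t => (hκd t).continuousAt
  have hg : ∀ t, GoodPoint η μ ν lam a b (v t) (κ t) := fun t => hgood _ (hvm t) _ (hκm t)
  -- the state, as a function of the slow and the fast variable
  set D : ℝ → ℝ := fun t => (a - v t) * (v t - b) with hD
  set E : ℝ → ℝ := fun t => relEnergy a b (v t) (κ t) with hEdef
  -- The term `κ * (a + b - 2 * v)` of `fastRate` cancels the contribution of the derivative of `D`,
  -- and the relative rate of `E` is `ratio` times `v'`.
  have hEd : ∀ t, HasDerivAt E (-D t * (E t * ratio η μ ν (v t) (κ t))) t := fun t => by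
    have := ((hκd t).mul (((hvd t).const_sub a).mul ((hvd t).sub_const b))).const_sub 1
    refine this.congr_deriv ?_
    simp only [hD, hEdef, fastRate, Pi.mul_apply]
    ring
  have hEc : Continuous E := continuous_iff_continuousAt.2 fun t => (hEd t).continuousAt
  set ρ : ℝ → ℝ := fun t => density Q (v t) (E t) with hρ
  have hρ0 : ∀ t, 0 < ρ t := fun t => density_pos _ _ _
  have hρc : Continuous ρ := continuous_iff_continuousAt.2 fun t =>
    continuousAt_density Q hvc.continuousAt hEc.continuousAt (hv0 _ (hvm t)) (hv1 _ (hvm t))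
      (hg t).rel_pos
  have hΦc : Continuous fun t => ratio η μ ν (v t) (κ t) := continuous_iff_continuousAt.2 fun t =>
    continuousAt_ratio η μ ν hvc.continuousAt hκc.continuousAt (hv0 _ (hvm t)).ne'
      (hg t).denom_pos.ne'
  set r : ℝ → ℝ := fun t => (-D t / v t - -D t * ratio η μ ν (v t) (κ t) +
    6 * v t * -D t / (1 - v t ^ 2)) / 4 with hr
  have hrc : Continuous r := by
    have n1 : ∀ t, v t ≠ 0 := fun t => (hv0 _ (hvm t)).ne'
    have n2 : ∀ t, 1 - v t ^ 2 ≠ 0 := fun t => by linarith [hv1 _ (hvm t)]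
    have hDc : Continuous D := by fun_prop
    exact (((hDc.neg.div hvc n1).sub (hDc.neg.mul hΦc)).add
      (((continuous_const.mul hvc).mul hDc.neg).div (by fun_prop) n2)).div_const 4
  have hρd : ∀ t, HasDerivAt ρ (ρ t * r t) t := fun t => by
    have := hasDerivAt_density (Q := Q) (hvd t) (hEd t) (hv0 _ (hvm t)) (hv1 _ (hvm t))
      (hg t).rel_pos
    refine this.congr_deriv ?_
    have hE0 : E t ≠ 0 := (hg t).rel_pos.ne'
    have : -D t * (E t * ratio η μ ν (v t) (κ t)) / E t = -D t * ratio η μ ν (v t) (κ t) := by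
      field_simp
    rw [this]
  set p : ℝ → ℝ := fun t => traverseRate η μ ν X Q (ρ t) (v t) (κ t) with hp
  have hdensc : ∀ z : ℝ × ℝ, z ∈ Set.Icc b a ×ˢ Set.Icc (0 : ℝ) 3 →
      ContinuousAt (fun z : ℝ × ℝ =>
        traverseRate η μ ν X Q (density Q z.1 (relEnergy a b z.1 z.2)) z.1 z.2) z := by
    rintro z ⟨hz1, hz2⟩
    have hgz := hgood _ hz1 _ hz2
    have c0 : ContinuousAt (fun z : ℝ × ℝ => relEnergy a b z.1 z.2) z :=
      continuousAt_relEnergy continuousAt_const continuousAt_const continuousAt_fst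
        continuousAt_snd
    have c1 := continuousAt_density Q continuousAt_fst c0 (hv0 _ hz1) (hv1 _ hz1) hgz.rel_pos
    have c2 := continuousAt_slowCoef η μ ν continuousAt_fst continuousAt_snd
      (hv0 _ hz1).ne' hgz.denom_pos.ne'
    have n1 : 3 * X * density Q z.1 (relEnergy a b z.1 z.2) ≠ 0 :=
      (mul_pos (by positivity) (density_pos _ _ _)).ne'
    have n2 := (hv0 _ hz1).ne'
    unfold traverseRate
    exact ((((by fun_prop : ContinuousAt (fun z : ℝ × ℝ => 4 * Q * (1 - z.1 ^ 2)) z).div₀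
      (continuousAt_const.mul c1) n1).mul (by fun_prop)).div₀ continuousAt_fst n2).div₀ c2
        hgz.slow_pos.ne'
  have hpc : Continuous p := continuous_iff_continuousAt.2 fun t =>
    ContinuousAt.comp (f := fun t => (v t, κ t)) (hdensc (v t, κ t) ⟨hvm t, hκm t⟩)
      (by fun_prop)
  have hp0 : ∀ t, 0 < p t := fun t => by
    have h1 := hv0 _ (hvm t)
    have h2 : 0 < 1 - v t ^ 2 := by linarith [hv1 _ (hvm t)]
    have h3 := (hg t).slow_pos
    have h4 := hρ0 t
    have h5 := (hκm t).1
    simp only [hp, traverseRate]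
    positivity
  -- The rate is a continuous function of `(v, κ)`, which stays in a compact rectangle.
  obtain ⟨C, hC⟩ : ∃ C, ∀ t, p t ≤ C := by
    obtain ⟨C, hC⟩ := (isCompact_Icc.prod isCompact_Icc).bddAbove_image
      (f := fun z : ℝ × ℝ => traverseRate η μ ν X Q (density Q z.1 (relEnergy a b z.1 z.2)) z.1 z.2)
      (K := Set.Icc b a ×ˢ Set.Icc (0 : ℝ) 3)
      fun z hz => (hdensc z hz).continuousWithinAt
    exact ⟨C, fun t => hC ⟨(v t, κ t), ⟨hvm t, hκm t⟩, rfl⟩⟩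
  have hΨd : ∀ t, HasDerivAt (fun t => planar e n (ρ t) (v t))
      ((ρ t * r t) • (e + v t • n) + (ρ t * -D t) • n) t := fun t => by
    have h1 := (hρd t).smul (((hvd t).smul_const n).const_add e)
    refine h1.congr_deriv ?_
    rw [smul_smul, add_comm]
  have henergy : ∀ t, energy (ρ t) (v t) * v t = Q * relEnergy a b (v t) (κ t) := fun t =>
    energy_density hQ (hv0 _ (hvm t)) (hv1 _ (hvm t)) (hg t).rel_pos
  -- At either end `D` tends to `0` and `κ` stays bounded, so that `E` tends to `1`. No limit of `κ`
  -- itself is needed.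
  have hlim : ∀ {l : Filter ℝ} {c ρc : ℝ}, c ∈ Set.Icc b a → (a - c) * (c - b) = 0 → 0 < ρc →
      energy ρc c * c = Q → Tendsto v l (𝓝 c) →
      Tendsto (fun t => planar e n (ρ t) (v t)) l (𝓝 (planar e n ρc c)) := by
    intro l c ρc hc hc0 hρc hcQ hvl
    have hDl : Tendsto D l (𝓝 0) := by
      rw [← hc0]
      exact (hvl.const_sub a).mul (hvl.sub_const b)
    have hκD : Tendsto (fun t => κ t * D t) l (𝓝 0) := by
      refine squeeze_zero_norm (a := fun t => 3 * |D t|) (fun t => ?_)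
        (by simpa using hDl.abs.const_mul 3)
      rw [norm_mul, Real.norm_eq_abs, Real.norm_eq_abs, abs_of_nonneg (hκm t).1]
      exact mul_le_mul_of_nonneg_right (hκm t).2 (abs_nonneg _)
    have hEl : Tendsto E l (𝓝 1) := by simpa [hEdef, relEnergy] using hκD.const_sub 1
    have hρl : Tendsto ρ l (𝓝 ρc) := by
      rw [← density_unique hQ (hv0 _ hc) (hv1 _ hc) hρc hcQ]
      exact tendsto_density Q hvl hEl (hv0 _ hc) (hv1 _ hc) one_pos
    exact hρl.smul ((hvl.smul_const n).const_add e)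
  refine hasProfile_of_reparam hΨd (by fun_prop) hpc hp0 hC
    (fun t => hf.planar_mem (hρ0 t) (hv1 _ (hvm t))) (fun t => ?_)
    (hlim ⟨hba.le, le_rfl⟩ (by ring) hρa rfl (tendsto_logistic_atBot hba))
    (hlim ⟨le_rfl, hba.le⟩ (by ring) hρb hE.symm (tendsto_logistic_atTop hba))
  have hfl : flux ξ (planar e n ρa a) = X • ((4 / 3 * Q) • e + (Q * (a + b)) • n) := by
    rw [hf.flux_planar hN hρa ha2, ← hQdef]
    have : 1 / 3 * (energy ρa a * (1 + 3 * a ^ 2)) = Q * (a + b) := by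
      rw [hQdef]; linear_combination -energy ρa a * hab
    rw [this]
  have hode := hf.planar_ode (η := η) (μ := μ) (ν := ν) hX hN (hρ0 t) (hv0 _ (hvm t))
    (hv1 _ (hvm t)) hab
    (hg t).denom_pos.ne' (hg t).slow_pos.ne' (henergy t) rfl rfl rfl
  rw [hfl, ← hode]
  congr 1
  rw [smul_add, smul_smul, smul_smul]
  congr 2 <;> simp only [hp, hr, hD] <;> ring

/-- Under `ξ ↦ -ξ` and `x ↦ -x` the dissipation, quadratic in `ξ` and linear in the derivative,
changes its sign, and so does the flux. -/
theorem hasProfile_reflect {η μ ν : ℝ} {ξ ψm ψp : Vec} (hRH : flux ξ ψm = flux ξ ψp)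
    (h : HasProfile η μ ν (-ξ) ψp ψm) : HasProfile η μ ν ξ ψm ψp := by
  obtain ⟨ψ, hψ⟩ := h
  have hd : ∀ x, deriv (fun x => ψ (-x)) x = -deriv ψ (-x) := fun x => deriv_comp_neg ψ x
  refine ⟨fun x => ψ (-x), hψ.contDiff.comp contDiff_neg, fun x => hψ.mem _, fun x α => ?_,
    hψ.tendsto_right.comp tendsto_neg_atBot_atTop, hψ.tendsto_left.comp tendsto_neg_atTop_atBot⟩
  have := hψ.ode (-x) α
  rw [flux_neg, flux_neg] at this
  rw [hd, hRH]
  simp only [lower_neg, Pi.neg_apply, neg_mul, mul_neg, neg_neg, Finset.sum_neg_distrib] at this ⊢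
  linarith

/-- Weak shocks have dissipation profiles. -/
theorem exists_profile_of_small_amplitude {η μ ν : ℝ} (hη : 0 < η) (hμ : 0 < μ) (hν : 0 < ν) :
    ∃ ε : ℝ, 0 < ε ∧ ∀ ξ ψm ψp : Vec, Spacelike ξ → IsLaxShock ξ ψm ψp →
      amplitude ψm ψp < ε → HasProfile η μ ν ξ ψm ψp := by
  set v₀ : ℝ := Real.sqrt (1 / 3) with hv₀
  have hv0 : 0 < v₀ := Real.sqrt_pos.2 (by norm_num)
  have hv : v₀ ^ 2 = 1 / 3 := Real.sq_sqrt (by norm_num)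
  obtain ⟨δ, hδ, hball⟩ := Metric.eventually_nhds_iff.1 (eventually_goodPoint hη hμ hν hv hv0)
  have hlam : 0 < sonicRate η μ ν v₀ := by unfold sonicRate; positivity
  have main : ∀ {e n ξ : Vec} {X ρa a ρb b : ℝ}, IsFrame e n → 0 < X → lower ξ = X • n →
      0 < ρa → 0 < ρb → 1 < 3 * a ^ 2 → 0 < a → a < 1 → 0 < b → a * b = 1 / 3 →
      energy ρa a * a = energy ρb b * b → a - b < δ →
      HasProfile η μ ν ξ (planar e n ρa a) (planar e n ρb b) := by
    intro e n ξ X ρa a ρb b hf hX hN hρa hρb ha3 ha0 ha1 hb0 hab hE hδ'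
    -- The velocities `a` and `b = 1 / (3 a)` lie on either side of `v₀`. A bound on `a - b` thus
    -- places the whole interval close to `v₀`.
    have hav : v₀ < a := by nlinarith
    have hbv : b < v₀ := by
      by_contra! h
      nlinarith [mul_le_mul h hav.le hv0.le hb0.le]
    have hnear : ∀ v ∈ Set.Icc b a, dist (a, b, v) (v₀, v₀, v₀) < δ := by
      rintro v ⟨h1, h2⟩
      simp only [Prod.dist_eq, Real.dist_eq]
      refine max_lt ?_ (max_lt ?_ ?_) <;> rw [abs_lt] <;> constructor <;> linarith
    refine hasProfile_of_goodPoint hf hX hN hρa hρb hb0 (hbv.trans hav) ha1 hab hE hlam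
      (fun v hv k hk => (hball (hnear v hv) (k, k) ⟨hk, hk⟩).1)
      (fun v hv k hk k' hk' => (hball (hnear v hv) (k, k') ⟨hk, hk'⟩).2.le)
  -- `1 / 2` is what the amplitude estimate requires, and its factor `2` turns `δ / 2` into `δ`.
  refine ⟨min (1 / 2) (δ / 2), by positivity, fun ξ ψm ψp hξ hshock hamp => ?_⟩
  rcases hshock.cases hξ with ⟨hz, hMa, hMb⟩ | ⟨hz, hMa, hMb⟩
  · obtain ⟨e, n, X, ρa, a, ρb, b, hf, hX, hN, hρa, hρb, rfl, rfl, ha3, ha0, ha1, hb0, hab, hE⟩ :=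
      exists_planar_pair hξ hshock.mem_left hshock.mem_right hz hMa hMb hshock.rankine_hugoniot
    have h1 := hf.abs_sub_lt_of_amplitude hρa (by nlinarith) hab (min_le_left _ _) hamp
    have h2 := min_le_right (1 / 2) (δ / 2)
    exact main hf hX hN hρa hρb ha3 ha0 ha1 hb0 hab hE (by linarith [(abs_lt.1 h1).1])
  -- The last family: the supersonic state is on the right, and the reflected front is of the first
  -- kind. The amplitude is now measured from the subsonic state.
  · have hξ' : Spacelike (-ξ) := by
      rw [spacelike_iff] at hξ ⊢
      rwa [lower_neg, mink_neg_left, mink_neg_right, neg_neg]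
    have hM : ∀ ψ, machSign (-ξ) ψ = machSign ξ ψ := fun ψ => by
      simp only [machSign, lower_neg, mink_neg_left, mink_neg_right, neg_neg, neg_sq]
    have hRH := hshock.rankine_hugoniot
    obtain ⟨e, n, X, ρa, a, ρb, b, hf, hX, hN, hρa, hρb, rfl, rfl, ha3, ha0, ha1, hb0, hab, hE⟩ :=
      exists_planar_pair hξ' hshock.mem_right hshock.mem_left
        (by rw [lower_neg, mink_neg_left]; linarith) (by rwa [hM]) (by rwa [hM])
        (by rw [flux_neg, flux_neg, hRH])
    have hb2 : b ^ 2 < 1 := by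
      have : a * b < a * 1 := by rw [hab]; nlinarith
      have := lt_of_mul_lt_mul_left this ha0.le
      nlinarith
    have h1 := hf.abs_sub_lt_of_amplitude hρb hb2 (by rw [mul_comm, hab]) (min_le_left _ _) hamp
    have h2 := min_le_right (1 / 2) (δ / 2)
    exact hasProfile_reflect hRH
      (main hf hX hN hρa hρb ha3 ha0 ha1 hb0 hab hE (by linarith [(abs_lt.1 h1).2]))

end BDN

end

theorem theorem1 (η μ ν : ℝ) (hη : 0 < η) (hμ : 0 < μ) (hν : 0 < ν) :
    (∃ ε : ℝ, 0 < ε ∧ ∀ ξ ψm ψp : BDN.Vec, BDN.Spacelike ξ → BDN.IsLaxShock ξ ψm ψp →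
      BDN.amplitude ψm ψp < ε → BDN.HasProfile η μ ν ξ ψm ψp) ∧
    (4 / 3 * η ≤ μ → (1 / (3 * η) - 1 / (9 * μ))⁻¹ < ν →
      ∀ ξ : BDN.Vec, BDN.Spacelike ξ →
        ∃ ψm ψp : BDN.Vec, BDN.IsLaxShock ξ ψm ψp ∧ ¬ BDN.HasProfile η μ ν ξ ψm ψp) := by
  exact ⟨BDN.exists_profile_of_small_amplitude hη hμ hν, fun hμη hν' _ hξ =>
    BDN.exists_shock_without_profile hη hμη hν' hξ⟩
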